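/- Let $0<q<1$, let $\ell\ge 1$ be an integer, put $N=\ell+1$, and let $M\in\mathbb{Z}$. **Quantum $SU(N)$.** $\mathcal{O}(SU_q(N))$ is the universal unital $\mathbb{C}$-algebra generated by $u_{ij}$, $1\le i,j\le N$, subject to $u_{ik}u_{jk}=q\,u_{jk}u_{ik}$ and $u_{ki}u_{kj}=q\,u_{kj}u_{ki}$ for $i<j$; $[u_{il},u_{jk}]=0$ and $[u_{ik},u_{jl}]=(q-q^{-1})u_{il}u_{jk}$ for $i<j$, $k<l$; and $\sum_{\sigma\in S_N}(-q)^{\iota(\sigma)}u_{\sigma(1)1}\cdots u_{\sigma(N)N}=1$, where $\iota(\sigma)$ is the number of inversions of $\sigma$. It is a Hopf $*$-algebra with $\Delta(u_{ij})=\sum_k u_{ik}\otimes u_{kj}$ and $u_{ij}^*=S(u_{ji})=(-q)^{j-i}D_{ij}$, where $D_{ij}$ is the quantum determinant of the matrix obtained from $(u_{kl})$ by deleting row $i$ and column $j$. Let $h$ be its Haar state (the unique bi-invariant state), and let $L^2(SU_q(N))$ be the associated GNS Hilbert space, the completion of $\mathcal{O}(SU_q(N))$ for $\langle x,y\rangle=h(x^*y)$.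 **The action.** Let $\mathcal{U}_q(\mathfrak{su}(N))$ be the quantized enveloping algebra, with generators $K_r^{\pm1},E_r,F_r=E_r^*$ ($1\le r\le\ell$), $K_r^*=K_r$, and Hopf structure $\Delta(K_r)=K_r\otimes K_r$, $\Delta(E_r)=E_r\otimes K_r+K_r^{-1}\otimes E_r$, $\epsilon(K_r)=1$, $\epsilon(E_r)=0$, $S(K_r)=K_r^{-1}$, $S(E_r)=-qE_r$. It acts on $\mathcal{O}(SU_q(N))$ by $d_\eta=(\langle S^{-1}(\eta),\cdot\rangle\otimes 1)\Delta$, where the dual pairing is determined by $\langle\eta,u_{ij}\rangle=\pi_{ij}(\eta)$ with $\pi(E_r)=e_{r+1,r}$ and $\pi(K_r)=\sum_j q^{\frac12(\delta_{j,r+1}-\delta_{j,r})}e_{jj}$ (and $\pi$ a $*$-representation on $\mathbb{C}^N$). Let $\mathcal{U}_q(\mathfrak{su}(\ell))$ be the unital subalgebra generated by $K_r^{\pm1},E_r,F_r$ with $r<\ell$. **Forms.** Let $\Lambda(\mathbb{C}^\ell)$ have orthonormal basis $e_I$, $I\subseteq\{1,\dots,\ell\}$. Put $\varepsilon_j^q(e_I)=0$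 if $j\in I$ and $\varepsilon_j^q(e_I)=(-q)^{-\#(I\cap\{1,\dots,j\})}e_{I\cup\{j\}}$ if $j\notin I$. Let $\sigma$ be the $*$-representation of $\mathcal{U}_q(\mathfrak{su}(\ell))$ on $\Lambda(\mathbb{C}^\ell)$ with $\sigma(K_r)e_I=q^{\frac12(\delta_{r,I}-\delta_{r+1,I})}e_I$ (where $\delta_{r,I}=1$ if $r\in I$ and $0$ otherwise), and with $\sigma(E_r)e_I=e_{(I\setminus\{r+1\})\cup\{r\}}$ if $r+1\in I$ and $r\notin I$, and $\sigma(E_r)e_I=0$ otherwise. The twisted antiholomorphic forms $\Omega_M^k$ of degree $k$ are the elements $\omega=\sum_{\#I=k}\omega_I\otimes e_I$ of $\mathcal{O}(SU_q(N))\otimes\Lambda^k(\mathbb{C}^\ell)$ such that $d_{K_\ell}(\omega_I)=q^{\frac{M-k}{2}-\frac12\delta_{\ell,I}}\omega_I$ for all $I$ and $(d_{\eta_{(1)}}\otimes\sigma(\eta_{(2)}))\omega=\epsilon(\eta)\omega$ for all $\eta\in\mathcal{U}_q(\mathfrak{su}(\ell))$. Let $L^2(\Omega_M^k,h)$ be the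 closure of $\Omega_M^k$ in $L^2(SU_q(N))\otimes\Lambda(\mathbb{C}^\ell)$. **Dirac operator and gradient.** Put $M_\ell=E_\ell$, $M_i=E_iM_{i+1}-q^{-1}M_{i+1}E_i$ for $i<\ell$, and $N_i=K_iK_{i+1}\cdots K_\ell$. Let $D_q$ be given by $\overline\partial+\overline\partial^\dagger$ on the forms, where $\overline\partial=\sum_{i=1}^\ell d_{N_iM_i^*}\otimes\varepsilon_i^q$ and $\overline\partial^\dagger=\sum_{i=1}^\ell d_{M_iN_i}\otimes(\varepsilon_i^q)^*$. Put $z_i=u_{Ni}$, and let $\mathcal{O}(\mathbb{C}P_q^\ell)$ be the unital $*$-subalgebra of $\mathcal{O}(SU_q(N))$ generated by the elements $z_iz_j^*$; it acts on forms by left multiplication. For $x\in\mathcal{O}(\mathbb{C}P_q^\ell)$ the gradient $\nabla(x):L^2(\Omega_M^0,h)\to L^2(\Omega_M^1,h)$ is the unique bounded operator with $\nabla(x)\omega=-[D_q,x]\omega$ for all $\omega\in\Omega_M^0$. **Proposition.** Let $y_\ell=\sum_{i=1}^{\ell}z_iz_i^*\in\mathcal{O}(\mathbb{C}P_q^\ell)$.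 Then the gradient $\nabla(y_\ell)$ exists as a bounded operator, and $$\nabla(y_\ell)^*\,\nabla(y_\ell)=q^{-1}\,y_\ell\,(1-q^2y_\ell)$$ as operators on $L^2(\Omega_M^0,h)$, where the element on the right-hand side acts by left multiplication. -/

import Mathlib

noncomputable section

namespace QuantumSU
open Finset

section Minors
variable {B : Type*} [Ring B] [Algebra ℂ B] {n m : ℕ}

/-- The quadratic relations of the quantum matrix algebra `O(M_q(n))`, for a matrix of elements of
an algebra `B`. -/
structure IsQuantumMatrix (q : ℂ) (U : Fin n → Fin m → B) : Prop where
  col : ∀ i j k, i < j → U i k * U j k = q • (U j k * U i k)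
  row : ∀ k i j, i < j → U k i * U k j = q • (U k j * U k i)
  comm : ∀ i j k l, i < j → k < l → U i l * U j k = U j k * U i l
  cross : ∀ i j k l, i < j → k < l →
    U i k * U j l - U j l * U i k = (q - q⁻¹) • (U i l * U j k)

lemma IsQuantumMatrix.transpose {q : ℂ} {U : Fin n → Fin m → B} (h : IsQuantumMatrix q U) :
    IsQuantumMatrix q (fun i j => U j i) where
  col i j k hij := h.row k i j hij
  row k i j hij := h.col i j k hij
  comm i j k l hij hkl := (h.comm k l i j hkl hij).symm
  cross i j k l hij hkl := by rw [h.cross k l i j hkl hij, h.comm k l i j hkl hij]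

/-- Number of elements of `I` that are smaller than `i`. -/
def rk {n : ℕ} (I : Finset (Fin n)) (i : Fin n) : ℕ := (I.filter (· < i)).card

/-- Quantum minors by expansion along the columns. -/
def minorAux (q : ℂ) (U : Fin n → Fin m → B) : List (Fin m) → Finset (Fin n) → B
  | [], I => if I = ∅ then 1 else 0
  | k :: ks, I => ∑ i ∈ I, (-q) ^ rk I i • (U i k * minorAux q U ks (I.erase i))

lemma rk_erase_lt {I : Finset (Fin n)} {i j : Fin n} (hi : i ∈ I) (h : i < j) :
    rk (I.erase i) j + 1 = rk I j := by
  unfold rk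
  rw [Finset.filter_erase, Finset.card_erase_add_one]
  simp [hi, h]

lemma rk_erase_le {I : Finset (Fin n)} {i j : Fin n} (h : j ≤ i) :
    rk (I.erase i) j = rk I j := by
  unfold rk
  rw [Finset.filter_erase, Finset.erase_eq_of_notMem]
  simp [h]

/-- Split a sum over ordered pairs of distinct elements -/
lemma sum_pairs {M : Type*} [AddCommMonoid M] (I : Finset (Fin n)) (f : Fin n → Fin n → M) :
    ∑ i ∈ I, ∑ j ∈ I.erase i, f i j
      = ∑ p ∈ (I ×ˢ I).filter (fun p => p.1 < p.2), (f p.1 p.2 + f p.2 p.1) := by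
  have h1 : ∑ i ∈ I, ∑ j ∈ I.erase i, f i j
      = ∑ p ∈ (I ×ˢ I).filter (fun p => p.1 ≠ p.2), f p.1 p.2 := by
    rw [Finset.sum_filter, Finset.sum_product]
    refine Finset.sum_congr rfl fun i _ => ?_
    rw [← Finset.sum_filter]
    refine Finset.sum_congr ?_ fun _ _ => rfl
    ext j; simp [and_comm, eq_comm]
  have h2 : (I ×ˢ I).filter (fun p => p.1 ≠ p.2)
      = (I ×ˢ I).filter (fun p => p.1 < p.2) ∪ (I ×ˢ I).filter (fun p => p.2 < p.1) := by
    ext ⟨a, b⟩; simp [← and_or_left, lt_or_lt_iff_ne]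
  have h3 : Disjoint ((I ×ˢ I).filter (fun p => p.1 < p.2))
      ((I ×ˢ I).filter (fun p => p.2 < p.1)) := by
    rw [Finset.disjoint_filter]
    intro p _ h h'; exact lt_asymm h h'
  rw [h1, h2, Finset.sum_union h3, Finset.sum_add_distrib]
  congr 1
  refine Finset.sum_bij' (fun p _ => (p.2, p.1)) (fun p _ => (p.2, p.1)) ?_ ?_ ?_ ?_ ?_ <;>
    simp <;> tauto

lemma minorAux_cons_congr {q : ℂ} {U : Fin n → Fin m → B} {ks ks' : List (Fin m)} {c : ℂ}
    (h : ∀ I, minorAux q U ks I = c • minorAux q U ks' I) (k : Fin m) (I : Finset (Fin n)) :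
    minorAux q U (k :: ks) I = c • minorAux q U (k :: ks') I := by
  simp only [minorAux, h, Finset.smul_sum, mul_smul_comm]
  exact Finset.sum_congr rfl fun i _ => smul_comm _ _ _

lemma minorAux_two (q : ℂ) (U : Fin n → Fin m → B) (k l : Fin m) (ks : List (Fin m))
    (I : Finset (Fin n)) :
    minorAux q U (k :: l :: ks) I = ∑ p ∈ (I ×ˢ I).filter (fun p => p.1 < p.2),
      (-q) ^ (rk I p.1 + rk (I.erase p.1) p.2) •
        ((U p.1 k * U p.2 l - q • (U p.2 k * U p.1 l)) *
          minorAux q U ks ((I.erase p.1).erase p.2)) := by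
  simp only [minorAux, Finset.smul_sum, Finset.mul_sum]
  rw [sum_pairs]
  refine Finset.sum_congr rfl fun p hp => ?_
  simp only [Finset.mem_filter, Finset.mem_product] at hp
  obtain ⟨⟨h1, h2⟩, hlt⟩ := hp
  rw [rk_erase_le (I := I) (i := p.2) (j := p.1) hlt.le, ← rk_erase_lt h1 hlt,
    Finset.erase_right_comm (a := p.2)]
  simp only [mul_smul_comm, smul_smul, sub_mul, smul_mul_assoc, mul_assoc, smul_sub]
  rw [← sub_eq_zero]
  module

lemma minorAux_same {q : ℂ} {U : Fin n → Fin m → B} (hU : IsQuantumMatrix q U) (k : Fin m)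
    (ks : List (Fin m)) (I : Finset (Fin n)) : minorAux q U (k :: k :: ks) I = 0 := by
  rw [minorAux_two]
  refine Finset.sum_eq_zero fun p hp => ?_
  simp only [Finset.mem_filter, Finset.mem_product] at hp
  rw [hU.col _ _ _ hp.2, sub_self, zero_mul, smul_zero]

lemma minorAux_swap {q : ℂ} (hq : q ≠ 0) {U : Fin n → Fin m → B} (hU : IsQuantumMatrix q U)
    {k l : Fin m} (hkl : k < l)
    (ks : List (Fin m)) (I : Finset (Fin n)) :
    minorAux q U (l :: k :: ks) I = (-q) • minorAux q U (k :: l :: ks) I := by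
  rw [minorAux_two, minorAux_two, Finset.smul_sum]
  refine Finset.sum_congr rfl fun p hp => ?_
  simp only [Finset.mem_filter, Finset.mem_product] at hp
  have h1 := hU.cross _ _ _ _ hp.2 hkl
  have h2 := hU.comm _ _ _ _ hp.2 hkl
  rw [smul_comm (-q), ← smul_mul_assoc (-q)]
  congr 2
  have h3 : U p.2 l * U p.1 k = U p.1 k * U p.2 l - (q - q⁻¹) • (U p.1 l * U p.2 k) := by
    rw [← h1]; abel
  rw [h3, ← h2]
  have : q * q⁻¹ = 1 := mul_inv_cancel₀ hq
  simp only [smul_sub, smul_smul, sub_smul, this]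
  module

lemma minorAux_cons_sorted {q : ℂ} (hq : q ≠ 0) {U : Fin n → Fin m → B} (hU : IsQuantumMatrix q U)
    (k : Fin m) (ks : List (Fin m)) (hks : ks.Pairwise (· < ·)) (I : Finset (Fin n)) :
    minorAux q U (k :: ks) I = if k ∈ ks then 0 else
      (-q) ^ rk ks.toFinset k • minorAux q U (ks.orderedInsert (· ≤ ·) k) I := by
  induction ks generalizing I with
  | nil => simp [rk]
  | cons a t ih =>
    rw [List.pairwise_cons] at hks
    have ht := ih hks.2
    rcases lt_trichotomy k a with h | h | h
    · have hn : k ∉ a :: t := by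
        intro hk
        rcases List.mem_cons.1 hk with rfl | hk
        · exact lt_irrefl _ h
        · exact lt_asymm h (hks.1 _ hk)
      have : rk (a :: t).toFinset k = 0 := by
        unfold rk
        rw [Finset.card_eq_zero, Finset.filter_eq_empty_iff]
        intro x hx
        rcases List.mem_cons.1 (List.mem_toFinset.1 hx) with rfl | hx
        · exact h.not_gt
        · exact (h.trans (hks.1 _ hx)).not_gt
      rw [if_neg hn, this, List.orderedInsert_cons_of_le _ _ h.le]
      simp
    · subst h; simp [minorAux_same hU]
    · rw [minorAux_swap hq hU h, List.orderedInsert_of_not_le _ _ h.not_ge]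
      have hne : k ≠ a := h.ne'
      by_cases hk : k ∈ t
      · have := minorAux_cons_congr (q := q) (U := U) (ks := k :: t) (ks' := t) (c := 0)
          (fun I => by rw [ht, if_pos hk, zero_smul]) a I
        rw [this]; simp [hk]
      · have := minorAux_cons_congr (q := q) (U := U) (ks := k :: t)
          (ks' := t.orderedInsert (· ≤ ·) k) (c := (-q) ^ rk t.toFinset k)
          (fun I => by rw [ht, if_neg hk]) a I
        rw [this, if_neg (by simp [hk, hne]), smul_smul]
        congr 1
        have ha : a ∉ t := fun ha => lt_irrefl _ (hks.1 _ ha)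
        rw [List.toFinset_cons]
        unfold rk
        rw [Finset.filter_insert, if_pos h, Finset.card_insert_of_notMem (by simp [ha]), pow_succ']

/-- The quantum minor with columns `J` and rows `I`. -/
def minor (q : ℂ) (U : Fin n → Fin m → B) (I : Finset (Fin n)) (J : Finset (Fin m)) : B :=
  minorAux q U (J.sort (· ≤ ·)) I

lemma pairwise_sort' (J : Finset (Fin m)) : (J.sort (· ≤ ·)).Pairwise (· < ·) :=
  (Finset.sortedLT_sort J).pairwise

lemma sort_toFinset' {l : List (Fin m)} (hl : l.Pairwise (· < ·)) :
    l.toFinset.sort (· ≤ ·) = l := by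
  refine (List.toFinset_sort (· ≤ ·) (hl.imp ne_of_lt)).2 (hl.imp le_of_lt)

lemma orderedInsert_sort {J : Finset (Fin m)} {k : Fin m} (hk : k ∉ J) :
    (J.sort (· ≤ ·)).orderedInsert (· ≤ ·) k = (insert k J).sort (· ≤ ·) := by
  have hp := List.perm_orderedInsert (· ≤ ·) k (J.sort (· ≤ ·))
  have h2 : ((J.sort (· ≤ ·)).orderedInsert (· ≤ ·) k).Pairwise (· ≤ ·) := by
    have := (pairwise_sort' J).imp le_of_lt
    exact this.orderedInsert k _
  have h3 : ((J.sort (· ≤ ·)).orderedInsert (· ≤ ·) k).Nodup := by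
    rw [hp.nodup_iff]; simp [hk]
  have h4 : ((J.sort (· ≤ ·)).orderedInsert (· ≤ ·) k).toFinset = insert k J := by
    rw [List.toFinset_eq_of_perm _ _ hp]; simp
  rw [← h4]
  exact ((List.toFinset_sort (· ≤ ·) h3).2 h2).symm

lemma minorAux_cons_sort {q : ℂ} (hq : q ≠ 0) {U : Fin n → Fin m → B} (hU : IsQuantumMatrix q U)
    (k : Fin m) (J : Finset (Fin m)) (I : Finset (Fin n)) :
    minorAux q U (k :: J.sort (· ≤ ·)) I = if k ∈ J then 0 else
      (-q) ^ rk J k • minor q U I (insert k J) := by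
  rw [minorAux_cons_sorted hq hU k _ (pairwise_sort' J) I]
  by_cases hk : k ∈ J
  · simp [hk]
  · rw [if_neg (by simpa using hk), if_neg hk, orderedInsert_sort hk, Finset.sort_toFinset, minor]

lemma minorAux_eq_zero {q : ℂ} {U : Fin n → Fin m → B} {ks : List (Fin m)} {I : Finset (Fin n)}
    (h : ks.length ≠ I.card) : minorAux q U ks I = 0 := by
  induction ks generalizing I with
  | nil =>
    rw [minorAux, if_neg]
    rintro rfl; simp at h
  | cons k t ih =>
    rw [minorAux]
    refine Finset.sum_eq_zero fun i hi => ?_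
    rw [ih, mul_zero, smul_zero]
    rw [Finset.card_erase_of_mem hi]
    intro h'
    have := Finset.card_pos.2 ⟨i, hi⟩
    simp at h
    omega

lemma sum_insert_erase {M : Type*} [AddCommMonoid M] {m : ℕ}
    (f : Fin m → Finset (Fin m) → M) :
    ∑ J : Finset (Fin m), ∑ l : Fin m, (if l ∈ J then 0 else f l J)
      = ∑ J : Finset (Fin m), ∑ l ∈ J, f l (J.erase l) := by
  rw [Finset.sum_comm]
  rw [Finset.sum_comm' (s := (Finset.univ : Finset (Finset (Fin m)))) (t := fun J => J)
    (f := fun J l => f l (J.erase l)) (t' := Finset.univ)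
    (s' := fun l => Finset.univ.filter (fun J => l ∈ J)) (by simp)]
  refine Finset.sum_congr rfl fun l _ => ?_
  simp_rw [← ite_not (l ∈ _)]
  rw [← Finset.sum_filter]
  refine Finset.sum_bij' (fun J _ => insert l J) (fun J _ => J.erase l) ?_ ?_ ?_ ?_ ?_ <;>
    simp +contextual [Finset.insert_erase]

theorem minorAux_mul {p : ℕ} {q : ℂ} (hq : q ≠ 0) {A : Fin n → Fin p → B} {A' : Fin p → Fin m → B}
    (hA : IsQuantumMatrix q A) (hc : ∀ i j k l, Commute (A i j) (A' k l))
    (ks : List (Fin m)) (I : Finset (Fin n)) :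
    minorAux q (fun i k => ∑ l, A i l * A' l k) ks I
      = ∑ J : Finset (Fin p), minor q A I J * minorAux q A' ks J := by
  have hcm : ∀ (ks : List (Fin p)) I k l, Commute (minorAux q A ks I) (A' k l) := by
    intro ks
    induction ks with
    | nil => intro I k l; rw [minorAux]; split_ifs <;> simp
    | cons a t ih =>
      intro I k l
      rw [minorAux]
      refine Commute.sum_left _ _ _ fun i _ => ?_
      exact (Commute.mul_left (hc _ _ _ _) (ih _ _ _)).smul_left _
  induction ks generalizing I with
  | nil =>
    rw [Finset.sum_eq_single ∅]
    · simp [minorAux, minor]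
    · intro J _ hJ; simp [minorAux, hJ]
    · simp
  | cons k t ih =>
    rw [minorAux]
    have step : ∀ i ∈ I, (-q) ^ rk I i • ((∑ l, A i l * A' l k) *
        minorAux q (fun i k => ∑ l, A i l * A' l k) t (I.erase i))
        = ∑ J : Finset (Fin p), ∑ l, ((-q) ^ rk I i • (A i l * minor q A (I.erase i) J)) *
          (A' l k * minorAux q A' t J) := by
      intro i _
      rw [ih, Finset.sum_mul_sum, Finset.sum_comm, Finset.smul_sum]
      refine Finset.sum_congr rfl fun J _ => ?_
      rw [Finset.smul_sum]
      refine Finset.sum_congr rfl fun l _ => ?_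
      rw [smul_mul_assoc]
      congr 1
      have := hcm (J.sort (· ≤ ·)) (I.erase i) l k
      rw [minor, mul_assoc, mul_assoc, ← mul_assoc (A' l k), ← this.eq, mul_assoc]
    rw [Finset.sum_congr rfl step, Finset.sum_comm]
    have step2 : ∀ J : Finset (Fin p), ∑ i ∈ I, ∑ l, ((-q) ^ rk I i •
        (A i l * minor q A (I.erase i) J)) * (A' l k * minorAux q A' t J)
        = ∑ l : Fin p, if l ∈ J then 0 else
            ((-q) ^ rk J l • minor q A I (insert l J)) * (A' l k * minorAux q A' t J) := by
      intro J
      rw [Finset.sum_comm]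
      refine Finset.sum_congr rfl fun l _ => ?_
      rw [← Finset.sum_mul]
      have := minorAux_cons_sort hq hA l J I
      rw [minorAux] at this
      simp only [minor] at this ⊢
      rw [this]
      split_ifs <;> simp
    rw [Finset.sum_congr rfl fun J _ => step2 J, sum_insert_erase]
    refine Finset.sum_congr rfl fun J _ => ?_
    rw [minorAux, Finset.mul_sum]
    refine Finset.sum_congr rfl fun l hl => ?_
    rw [Finset.insert_erase hl, rk_erase_le le_rfl, smul_mul_assoc, mul_smul_comm]

/-- The identity matrix. -/
def idMat (n : ℕ) : Fin n → Fin n → ℂ := fun i j => if i = j then 1 else 0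

lemma minorAux_idMat (q : ℂ) (ks : List (Fin n)) (hks : ks.Pairwise (· < ·))
    (J : Finset (Fin n)) :
    minorAux q (idMat n) ks J = if J = ks.toFinset then 1 else 0 := by
  induction ks generalizing J with
  | nil => simp only [minorAux, List.toFinset_nil]; congr
  | cons k t ih =>
    rw [List.pairwise_cons] at hks
    have hk : k ∉ t := fun ha => lt_irrefl _ (hks.1 _ ha)
    rw [minorAux]
    have ih' := ih hks.2
    have e : ∀ i ∈ J, (-q) ^ rk J i • (idMat n i k * minorAux q (idMat n) t (J.erase i))
        = if i = k then (-q) ^ rk J k • minorAux q (idMat n) t (J.erase k) else 0 := by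
      intro i _
      by_cases h : i = k
      · subst h; simp [idMat]
      · simp [idMat, h]
    rw [Finset.sum_congr rfl e, Finset.sum_ite_eq']
    split_ifs with h1 h2 h2
    · rw [ih', h2]
      have : rk (k :: t).toFinset k = 0 := by
        unfold rk
        rw [Finset.card_eq_zero, Finset.filter_eq_empty_iff]
        intro x hx
        rcases List.mem_cons.1 (List.mem_toFinset.1 hx) with rfl | hx
        · exact lt_irrefl _
        · exact (hks.1 _ hx).not_gt
      rw [this, if_pos]
      · simp
      · rw [List.toFinset_cons, Finset.erase_insert]; simpa using hk
    · rw [ih', if_neg, smul_zero]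
      intro h3; apply h2
      rw [List.toFinset_cons, ← h3, Finset.insert_erase h1]
    · exfalso; apply h1; rw [h2]; simp
    · rfl

lemma minorAux_map {C : Type*} [Ring C] [Algebra ℂ C] (f : B →ₐ[ℂ] C) (q : ℂ)
    (U : Fin n → Fin m → B) (ks : List (Fin m)) (I : Finset (Fin n)) :
    f (minorAux q U ks I) = minorAux q (fun i j => f (U i j)) ks I := by
  induction ks generalizing I with
  | nil => rw [minorAux, minorAux]; split_ifs <;> simp
  | cons k t ih => simp [minorAux, ih]

lemma IsQuantumMatrix.map {C : Type*} [Ring C] [Algebra ℂ C] (f : B →ₐ[ℂ] C) {q : ℂ}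
    {U : Fin n → Fin m → B} (h : IsQuantumMatrix q U) : IsQuantumMatrix q (fun i j => f (U i j)) where
  col i j k hij := by rw [← map_mul, h.col _ _ _ hij]; simp
  row i j k hij := by rw [← map_mul, h.row _ _ _ hij]; simp
  comm i j k l hij hkl := by rw [← map_mul, h.comm _ _ _ _ hij hkl]; simp
  cross i j k l hij hkl := by rw [← map_mul, ← map_mul, ← map_sub, h.cross _ _ _ _ hij hkl]; simp

/-- Expansion in sorted minors -/
lemma minorAux_expand {q : ℂ} (hq : q ≠ 0) {U : Fin n → Fin m → B} (hU : IsQuantumMatrix q U)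
    (ks : List (Fin m)) (I : Finset (Fin n)) :
    minorAux q U ks I = ∑ J : Finset (Fin m), minorAux q (idMat m) ks J • minor q U I J := by
  have := minorAux_mul hq hU (A' := fun i j => algebraMap ℂ B (idMat m i j))
    (fun i j k l => (Algebra.commutes _ _).symm) ks I
  have h2 : (fun i k => ∑ l, U i l * algebraMap ℂ B (idMat m l k)) = U := by
    ext i k
    simp [idMat, apply_ite (algebraMap ℂ B)]
  rw [h2] at this
  rw [this]
  refine Finset.sum_congr rfl fun J _ => ?_
  have := minorAux_map (Algebra.ofId ℂ B) q (idMat m) ks J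
  simp only [Algebra.ofId_apply] at this
  rw [← this, Algebra.smul_def, Algebra.commutes]

lemma minorAux_expand_univ {q : ℂ} (hq : q ≠ 0) {U : Fin n → Fin n → B}
    (hU : IsQuantumMatrix q U) (ks : List (Fin n)) :
    minorAux q U ks univ = minorAux q (idMat n) ks univ • minor q U univ univ := by
  rw [minorAux_expand hq hU, Finset.sum_eq_single univ]
  · intro J _ hJ
    rw [minor, minorAux_eq_zero (ks := J.sort (· ≤ ·)), smul_zero]
    rw [Finset.length_sort]
    exact fun h => hJ ((Finset.card_eq_iff_eq_univ J).1 (by simpa using h))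
  · simp

lemma minor_mul_univ {q : ℂ} (hq : q ≠ 0) {A A' : Fin n → Fin n → B}
    (hA : IsQuantumMatrix q A) (hc : ∀ i j k l, Commute (A i j) (A' k l)) :
    minor q (fun i k => ∑ l, A i l * A' l k) univ univ
      = minor q A univ univ * minor q A' univ univ := by
  rw [minor, minorAux_mul hq hA hc, Finset.sum_eq_single univ]
  · rfl
  · intro J _ hJ
    rw [minor, minorAux_eq_zero (ks := J.sort (· ≤ ·)), zero_mul]
    rw [Finset.length_sort]
    exact fun h => hJ ((Finset.card_eq_iff_eq_univ J).1 (by simpa using h))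
  · simp

/-- Peeling off the last column -/
lemma minorAux_append (q : ℂ) (U : Fin n → Fin m → B) (ks : List (Fin m)) (k : Fin m)
    (I : Finset (Fin n)) :
    minorAux q U (ks ++ [k]) I = ∑ i ∈ I, (-q) ^ (I.filter (i < ·)).card •
      (minorAux q U ks (I.erase i) * U i k) := by
  induction ks generalizing I with
  | nil =>
    simp only [List.nil_append, minorAux]
    refine Finset.sum_congr rfl fun i hi => ?_
    by_cases h : I.erase i = ∅
    · have hI : I = {i} := by
        rw [← Finset.insert_erase hi, h]
        rfl
      have h1 : rk I i = 0 := by rw [hI]; unfold rk; simp [Finset.filter_singleton]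
      have h2 : (I.filter (i < ·)).card = 0 := by rw [hI]; simp [Finset.filter_singleton]
      rw [h1, h2]; simp
    · simp [h]
  | cons a t ih =>
    rw [List.cons_append, minorAux]
    simp only [ih, minorAux, Finset.mul_sum, Finset.sum_mul, Finset.smul_sum]
    conv_rhs => rw [Finset.sum_comm' (t' := I) (s' := fun i => I.erase i)
      (by intro x y; simp [eq_comm]; tauto)]
    refine Finset.sum_congr rfl fun i hi => ?_
    refine Finset.sum_congr rfl fun j hj => ?_
    rw [Finset.mem_erase] at hj
    rw [Finset.erase_right_comm (a := j), mul_smul_comm, smul_mul_assoc, smul_smul, smul_smul,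
      ← pow_add, ← pow_add, mul_assoc]
    congr 2
    rcases lt_or_gt_of_ne hj.1 with h | h
    · have h1 := rk_erase_lt hj.2 h
      have h2 : ((I.erase i).filter (j < ·)).card + 1 = (I.filter (j < ·)).card := by
        rw [Finset.filter_erase, Finset.card_erase_add_one]; simp [hi, h]
      omega
    · have h1 := rk_erase_le (I := I) h.le
      have h2 : ((I.erase i).filter (j < ·)).card = (I.filter (j < ·)).card := by
        rw [Finset.filter_erase, Finset.erase_eq_of_notMem]; simp [h.le]
      omega

/-- A doubly alternating sum, used to compare row and column expansions. -/
def dblSum (q : ℂ) (U : Fin n → Fin m → B) : ℕ → Finset (Fin n) → Finset (Fin m) → B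
  | 0, I, J => if I = ∅ ∧ J = ∅ then 1 else 0
  | d + 1, I, J => ∑ i ∈ I, ∑ j ∈ J, ((-q) ^ rk I i * (-q) ^ rk J j) •
      (U i j * dblSum q U d (I.erase i) (J.erase j))

/-- A quantum factorial. -/
def qfac (q : ℂ) : ℕ → ℂ
  | 0 => 1
  | d + 1 => (∑ t ∈ Finset.range (d + 1), ((-q) ^ t) ^ 2) * qfac q d

lemma sum_rk {M : Type*} [AddCommMonoid M] (J : Finset (Fin m)) (f : ℕ → M) :
    ∑ j ∈ J, f (rk J j) = ∑ t ∈ Finset.range J.card, f t := by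
  induction J using Finset.induction_on_max with
  | empty => simp
  | insert a s hs ih =>
    have ha : a ∉ s := fun h => lt_irrefl _ (hs a h)
    rw [Finset.sum_insert ha, Finset.card_insert_of_notMem ha, Finset.sum_range_succ, add_comm,
      ← ih]
    congr 1
    · refine Finset.sum_congr rfl fun j hj => ?_
      congr 1; unfold rk
      rw [Finset.filter_insert, if_neg (hs j hj).not_gt]
    · congr 1; unfold rk
      rw [Finset.filter_insert, if_neg (lt_irrefl _), Finset.filter_true_of_mem hs]

lemma dblSum_eq {q : ℂ} (hq : q ≠ 0) {U : Fin n → Fin m → B} (hU : IsQuantumMatrix q U) (d : ℕ)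
    (I : Finset (Fin n)) (J : Finset (Fin m)) (hJ : J.card = d) :
    dblSum q U d I J = qfac q d • minor q U I J := by
  induction d generalizing I J with
  | zero =>
    rw [Finset.card_eq_zero] at hJ; subst hJ
    simp [dblSum, minor, minorAux, qfac]
  | succ d ih =>
    rw [dblSum, Finset.sum_comm]
    have e : ∀ j ∈ J, ∑ i ∈ I, ((-q) ^ rk I i * (-q) ^ rk J j) •
        (U i j * dblSum q U d (I.erase i) (J.erase j))
        = (((-q) ^ rk J j) ^ 2) • (qfac q d • minor q U I J) := by
      intro j hj
      have h1 : ∀ i, dblSum q U d (I.erase i) (J.erase j)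
          = qfac q d • minor q U (I.erase i) (J.erase j) := fun i =>
        ih _ _ (by rw [Finset.card_erase_of_mem hj, hJ]; rfl)
      have h2 := minorAux_cons_sort hq hU j (J.erase j) I
      rw [if_neg (by simp), Finset.insert_erase hj, rk_erase_le le_rfl, minorAux] at h2
      simp only [h1]
      rw [pow_two, mul_smul, smul_comm ((-q) ^ rk J j) (qfac q d), ← h2, Finset.smul_sum,
        Finset.smul_sum]
      refine Finset.sum_congr rfl fun i _ => ?_
      rw [minor, mul_smul_comm]
      module
    rw [Finset.sum_congr rfl e, sum_rk J (fun t => (((-q) ^ t) ^ 2) • (qfac q d • minor q U I J)),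
      hJ, ← Finset.sum_smul, smul_smul, qfac]

lemma dblSum_transpose (q : ℂ) {U : Fin n → Fin m → B} (d : ℕ)
    (I : Finset (Fin n)) (J : Finset (Fin m)) :
    dblSum q (fun j i => U i j) d J I = dblSum q U d I J := by
  induction d generalizing I J with
  | zero => simp [dblSum, and_comm]
  | succ d ih =>
    rw [dblSum, dblSum, Finset.sum_comm]
    simp only [ih, mul_comm]

lemma qfac_ne_zero (q : ℝ) (d : ℕ) : qfac (q : ℂ) d ≠ 0 := by
  induction d with
  | zero => simp [qfac]
  | succ d ih =>
    rw [qfac]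
    refine mul_ne_zero ?_ ih
    have : (∑ t ∈ Finset.range (d + 1), ((-(q : ℂ)) ^ t) ^ 2)
        = ((∑ t ∈ Finset.range (d + 1), ((-q) ^ t) ^ 2 : ℝ) : ℂ) := by push_cast; rfl
    rw [this]
    refine Complex.ofReal_ne_zero.2 (ne_of_gt ?_)
    rw [Finset.sum_range_succ']
    have := Finset.sum_nonneg (s := Finset.range d) (f := fun t => ((-q) ^ (t + 1)) ^ 2)
      (fun _ _ => sq_nonneg _)
    simp only [pow_zero, one_pow]
    linarith

theorem minor_transpose {q : ℝ} (hq : q ≠ 0) {U : Fin n → Fin m → B}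
    (hU : IsQuantumMatrix (q : ℂ) U) (I : Finset (Fin n)) (J : Finset (Fin m)) :
    minor (q : ℂ) (fun j i => U i j) J I = minor (q : ℂ) U I J := by
  have hq' : (q : ℂ) ≠ 0 := by exact_mod_cast hq
  by_cases h : I.card = J.card
  · have h1 := dblSum_eq hq' hU J.card I J rfl
    have h2 := dblSum_eq hq' hU.transpose J.card J I h
    rw [dblSum_transpose, h1] at h2
    exact ((smul_right_injective B (qfac_ne_zero q J.card)) h2).symm
  · rw [minor, minor, minorAux_eq_zero, minorAux_eq_zero]
    · rw [Finset.length_sort]; exact fun h' => h h'.symm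
    · rw [Finset.length_sort]; exact h

lemma rk_map {n' : ℕ} (f : Fin n' ↪o Fin n) (I : Finset (Fin n')) (i : Fin n') :
    rk (I.map f.toEmbedding) (f i) = rk I i := by
  unfold rk
  rw [Finset.filter_map, Finset.card_map]
  congr 1
  ext x
  simp

lemma minorAux_submatrix {n' m' : ℕ} (q : ℂ) (U : Fin n → Fin m → B) (f : Fin n' ↪o Fin n)
    (g : Fin m' → Fin m) (ks : List (Fin m')) (I : Finset (Fin n')) :
    minorAux q (fun i j => U (f i) (g j)) ks I = minorAux q U (ks.map g) (I.map f.toEmbedding) := by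
  induction ks generalizing I with
  | nil => simp [minorAux]
  | cons k t ih =>
    rw [minorAux, List.map_cons, minorAux, Finset.sum_map]
    refine Finset.sum_congr rfl fun i _ => ?_
    rw [ih, Finset.map_erase]
    simp only [RelEmbedding.coe_toEmbedding, rk_map]

/-- The number of inversions of a permutation. -/
def inversions {n : ℕ} (σ : Equiv.Perm (Fin n)) : ℕ :=
  (univ.filter fun p : Fin n × Fin n => p.1 < p.2 ∧ σ p.2 < σ p.1).card

/-- The quantum determinant `∑_σ (-q)^{ι(σ)} U_{σ(1)1} ⋯ U_{σ(n)n}`. -/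
def qdet {n : ℕ} (q : ℂ) (U : Fin n → Fin n → B) : B :=
  ∑ σ : Equiv.Perm (Fin n), (-q) ^ inversions σ • (List.ofFn fun j => U (σ j) j).prod

/-- The permutation of `Fin (n + 1)` with first value `i`, which continues as `τ`. -/
def permCons (i : Fin (n + 1)) (τ : Equiv.Perm (Fin n)) : Equiv.Perm (Fin (n + 1)) :=
  Equiv.ofBijective (Fin.cons i (fun j => i.succAbove (τ j))) <| by
    rw [← Finite.injective_iff_bijective, Fin.cons_injective_iff]
    refine ⟨?_, fun a b h => τ.injective (Fin.succAbove_right_injective h)⟩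
    rintro ⟨j, hj⟩
    exact Fin.succAbove_ne _ _ hj

@[simp] lemma permCons_zero (i : Fin (n + 1)) (τ : Equiv.Perm (Fin n)) : permCons i τ 0 = i := rfl
@[simp] lemma permCons_succ (i : Fin (n + 1)) (τ : Equiv.Perm (Fin n)) (j : Fin n) :
    permCons i τ j.succ = i.succAbove (τ j) := rfl

lemma permCons_bijective :
    Function.Bijective (fun p : Fin (n + 1) × Equiv.Perm (Fin n) => permCons p.1 p.2) := by
  rw [Fintype.bijective_iff_injective_and_card]
  constructor
  · rintro ⟨i, τ⟩ ⟨i', τ'⟩ h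
    have h0 : i = i' := by simpa using congrArg (fun f => f 0) h
    subst h0
    congr 1
    ext j : 1
    have := congrArg (fun f => f j.succ) h
    exact Fin.succAbove_right_injective (p := i) this
  · simp [Fintype.card_perm, Nat.factorial_succ]

lemma inversions_permCons (i : Fin (n + 1)) (τ : Equiv.Perm (Fin n)) :
    inversions (permCons i τ) = i + inversions τ := by
  unfold inversions
  simp only [Finset.card_filter, Fintype.sum_prod_type, Fin.sum_univ_succ, permCons_zero,
    permCons_succ, Fin.succ_pos, Fin.succ_lt_succ_iff, true_and, false_and, if_false,
    Fin.not_lt_zero, zero_add, Fin.succAbove_lt_succAbove_iff]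
  congr 1
  · rw [Equiv.sum_comp τ (fun j => if i.succAbove j < i then 1 else 0)]
    rw [← Finset.card_filter]
    have : (univ.filter fun j : Fin n => i.succAbove j < i) = univ.filter fun j => j.val < i.val := by
      ext j
      rw [Finset.mem_filter, Finset.mem_filter, Fin.succAbove_lt_iff_castSucc_lt, Fin.lt_def]
      rfl
    rw [this, Fin.card_filter_val_lt]
    omega

lemma map_succAbove_univ (i : Fin (n + 1)) :
    (univ : Finset (Fin n)).map (Fin.succAboveOrderEmb i).toEmbedding = univ.erase i := by
  ext j
  simp only [Finset.mem_map, Finset.mem_univ, true_and, Finset.mem_erase, and_true]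
  exact Fin.exists_succAbove_eq_iff

lemma rk_univ (i : Fin n) : rk univ i = i := by
  unfold rk
  have : (univ.filter fun j : Fin n => j < i) = univ.filter fun j : Fin n => j.val < i.val := rfl
  rw [this, Fin.card_filter_val_lt]
  omega

theorem sum_perm_eq_minorAux (q : ℂ) (U : Fin n → Fin m → B) (k : Fin n → Fin m) :
    ∑ σ : Equiv.Perm (Fin n), (-q) ^ inversions σ • (List.ofFn fun j => U (σ j) (k j)).prod
      = minorAux q U (List.ofFn k) univ := by
  induction n with
  | zero => simp [minorAux, inversions]
  | succ n ih =>
    rw [← permCons_bijective.sum_comp, Fintype.sum_prod_type, List.ofFn_succ, minorAux]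
    refine Finset.sum_congr rfl fun i _ => ?_
    have := ih (fun a b => U (i.succAbove a) b) (fun j => k j.succ)
    have h2 := minorAux_submatrix q U (Fin.succAboveOrderEmb i) id (List.ofFn fun j => k j.succ) univ
    rw [map_succAbove_univ, List.map_id] at h2
    rw [← h2]
    simp only [id, Fin.succAboveOrderEmb_apply]
    rw [← this, rk_univ, Finset.mul_sum, Finset.smul_sum]
    refine Finset.sum_congr rfl fun τ _ => ?_
    rw [inversions_permCons, List.ofFn_succ, List.prod_cons, mul_smul_comm, smul_smul, pow_add]
    simp

theorem qdet_eq_minor (q : ℂ) (U : Fin n → Fin n → B) : qdet q U = minor q U univ univ := by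
  rw [minor, Fin.sort_univ, ← List.ofFn_id]
  exact sum_perm_eq_minorAux q U id

/-- The cofactors `(-q)^{i-j} D_{N∖{j}, N∖{i}}`: the quantum determinant of `U` with row `j` and
column `i` removed, with a sign. -/
def cofactor (q : ℂ) (U : Fin (n + 1) → Fin (n + 1) → B) (i j : Fin (n + 1)) : B :=
  (-q) ^ ((i : ℤ) - (j : ℤ)) • qdet q (fun a b : Fin n => U (j.succAbove a) (i.succAbove b))

lemma map_succAbove_finRange (i : Fin (n + 1)) :
    (List.finRange n).map i.succAbove = (univ.erase i).sort (· ≤ ·) := by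
  rw [← map_succAbove_univ i]
  have h : ((List.finRange n).map i.succAbove).Pairwise (· < ·) := by
    rw [List.pairwise_map]
    have := pairwise_sort' (univ : Finset (Fin n))
    rw [Fin.sort_univ] at this
    exact this.imp fun h => Fin.strictMono_succAbove i h
  rw [← sort_toFinset' h]
  congr 1
  ext j
  rw [Finset.mem_map]
  simp only [List.mem_toFinset, List.mem_map, List.mem_finRange, true_and, Finset.mem_univ]
  rfl

lemma cofactor_eq_minor (q : ℂ) (U : Fin (n + 1) → Fin (n + 1) → B) (i j : Fin (n + 1)) :
    cofactor q U i j = (-q) ^ ((i : ℤ) - (j : ℤ)) • minor q U (univ.erase j) (univ.erase i) := by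
  rw [cofactor, qdet_eq_minor, minor, Fin.sort_univ]
  have h2 := minorAux_submatrix q U (Fin.succAboveOrderEmb j) i.succAbove (List.finRange n) univ
  rw [map_succAbove_univ, map_succAbove_finRange] at h2
  rw [minor, ← h2]
  rfl

lemma card_filter_gt (i : Fin (n + 1)) : ((univ : Finset (Fin (n + 1))).filter (i < ·)).card = n - i := by
  have h : (univ.filter (i < ·)) = Finset.Ioi i := by ext; simp
  rw [h, Fin.card_Ioi]
  omega

lemma coeff_append (q : ℂ) (i j : Fin (n + 1)) :
    minorAux q (idMat (n + 1)) ((univ.erase i).sort (· ≤ ·) ++ [j]) univ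
      = if i = j then (-q) ^ (n - i : ℕ) else 0 := by
  rw [minorAux_append, Finset.sum_eq_single j]
  · rw [minorAux_idMat _ _ (pairwise_sort' _), Finset.sort_toFinset, card_filter_gt]
    have : (univ.erase j = univ.erase i) ↔ i = j := by
      constructor
      · intro h
        by_contra hne
        have : i ∈ univ.erase j := by simp [hne]
        rw [h] at this; simp at this
      · rintro rfl; rfl
    simp only [this]
    split_ifs with h
    · subst h; simp [idMat]
    · simp
  · intro k _ hk; simp [idMat, hk]
  · simp

lemma coeff_cons {q : ℂ} (i j : Fin (n + 1)) :
    minorAux q (idMat (n + 1)) (j :: (univ.erase i).sort (· ≤ ·)) univ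
      = if i = j then (-q) ^ (i : ℕ) else 0 := by
  rw [minorAux, Finset.sum_eq_single j]
  · rw [minorAux_idMat _ _ (pairwise_sort' _), Finset.sort_toFinset, rk_univ]
    have : (univ.erase j = univ.erase i) ↔ i = j := by
      constructor
      · intro h
        by_contra hne
        have : i ∈ univ.erase j := by simp [hne]
        rw [h] at this; simp at this
      · rintro rfl; rfl
    simp only [this]
    split_ifs with h
    · subst h; simp [idMat]
    · simp
  · intro k _ hk; simp [idMat, hk]
  · simp

/-- Laplace expansion: the cofactor matrix is a left inverse, up to the determinant. -/
theorem cofactor_mul {q : ℂ} (hq : q ≠ 0) {U : Fin (n + 1) → Fin (n + 1) → B}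
    (hU : IsQuantumMatrix q U) (i j : Fin (n + 1)) :
    ∑ k, cofactor q U i k * U k j = if i = j then qdet q U else 0 := by
  have h := minorAux_expand_univ hq hU ((univ.erase i).sort (· ≤ ·) ++ [j])
  rw [coeff_append, minorAux_append, ← qdet_eq_minor] at h
  have hq' : (-q) ≠ 0 := neg_ne_zero.2 hq
  have e : ∑ k, cofactor q U i k * U k j = (-q) ^ ((i : ℤ) - n) •
      ∑ k ∈ univ, (-q) ^ (univ.filter (k < ·)).card •
        (minorAux q U ((univ.erase i).sort (· ≤ ·)) (univ.erase k) * U k j) := by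
    rw [Finset.smul_sum]
    refine Finset.sum_congr rfl fun k _ => ?_
    rw [cofactor_eq_minor, card_filter_gt, smul_mul_assoc, smul_smul, ← zpow_natCast,
      ← zpow_add₀ hq', minor]
    congr 2
    have := k.is_le
    push_cast [this]
    ring
  rw [e, h]
  split_ifs with hij
  · rw [smul_smul, ← zpow_natCast, ← zpow_add₀ hq']
    have := i.is_le
    push_cast [this]
    simp
  · simp

/-- Laplace expansion: the cofactor matrix is a right inverse, up to the determinant. -/
theorem mul_cofactor {q : ℝ} (hq : q ≠ 0) {U : Fin (n + 1) → Fin (n + 1) → B}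
    (hU : IsQuantumMatrix (q : ℂ) U) (i j : Fin (n + 1)) :
    ∑ k, U i k * cofactor (q : ℂ) U k j = if i = j then qdet (q : ℂ) U else 0 := by
  have hqc : (q : ℂ) ≠ 0 := by exact_mod_cast hq
  have hq' : (-(q : ℂ)) ≠ 0 := neg_ne_zero.2 hqc
  have h := minorAux_expand_univ hqc hU.transpose (i :: (univ.erase j).sort (· ≤ ·))
  rw [coeff_cons, minorAux, minor_transpose hq hU, ← qdet_eq_minor] at h
  have e : ∑ k, U i k * cofactor (q : ℂ) U k j = (-(q : ℂ)) ^ (-(j : ℤ)) •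
      ∑ k ∈ univ, (-(q : ℂ)) ^ rk univ k • (U i k *
        minorAux (q : ℂ) (fun a b => U b a) ((univ.erase j).sort (· ≤ ·)) (univ.erase k)) := by
    rw [Finset.smul_sum]
    refine Finset.sum_congr rfl fun k _ => ?_
    rw [cofactor_eq_minor, ← minor_transpose hq hU, rk_univ, mul_smul_comm, smul_smul,
      ← zpow_natCast, ← zpow_add₀ hq', minor]
    congr 2
    ring
  rw [e, h]
  by_cases hij : i = j
  · subst hij
    rw [if_pos rfl, if_pos rfl, smul_smul, ← zpow_natCast, ← zpow_add₀ hq']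
    simp
  · rw [if_neg hij, if_neg (Ne.symm hij)]; simp

/-- The braiding matrix. -/
def rMat (q : ℂ) (n : ℕ) (x y : Fin n × Fin n) : ℂ :=
  (if y = x.swap then (if x.1 = x.2 then q else 1) else 0) +
    (if y = x then (if x.1 < x.2 then q - q⁻¹ else 0) else 0)

lemma rMat_symm (q : ℂ) (n : ℕ) (x y : Fin n × Fin n) : rMat q n x y = rMat q n y x := by
  obtain ⟨a, b⟩ := x
  obtain ⟨c, d⟩ := y
  simp only [rMat, Prod.swap, Prod.mk.injEq]
  congr 1
  · by_cases h : c = b ∧ d = a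
    · obtain ⟨rfl, rfl⟩ := h
      simp [eq_comm]
    · rw [if_neg h, if_neg]
      tauto
  · by_cases h : c = a ∧ d = b
    · obtain ⟨rfl, rfl⟩ := h
      simp
    · rw [if_neg h, if_neg]
      tauto

/-- The braiding matrix over `B`. -/
def rMatB (B : Type*) [Ring B] [Algebra ℂ B] (q : ℂ) (n : ℕ) :
    Matrix (Fin n × Fin n) (Fin n × Fin n) B := fun x y => algebraMap ℂ B (rMat q n x y)

/-- The matrix `U₁ U₂` on the tensor square. -/
def twoLeg (U : Fin n → Fin n → B) : Matrix (Fin n × Fin n) (Fin n × Fin n) B :=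
  fun x y => U x.1 y.1 * U x.2 y.2

lemma rMatB_mul_apply (q : ℂ) (T : Matrix (Fin n × Fin n) (Fin n × Fin n) B)
    (x y : Fin n × Fin n) :
    (rMatB B q n * T) x y = (if x.1 = x.2 then q else 1) • T x.swap y +
      (if x.1 < x.2 then q - q⁻¹ else 0) • T x y := by
  simp only [Matrix.mul_apply, rMatB, rMat, ← Algebra.smul_def, add_smul, Finset.sum_add_distrib,
    ite_smul (p := _ = _), zero_smul, Finset.sum_ite_eq', Finset.mem_univ, if_true]

lemma mul_rMatB_apply (q : ℂ) (T : Matrix (Fin n × Fin n) (Fin n × Fin n) B)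
    (x y : Fin n × Fin n) :
    (T * rMatB B q n) x y = (if y.1 = y.2 then q else 1) • T x y.swap +
      (if y.1 < y.2 then q - q⁻¹ else 0) • T x y := by
  simp only [Matrix.mul_apply, rMatB, ← Algebra.commutes, ← Algebra.smul_def]
  simp only [rMat_symm q n _ y]
  simp only [rMat, add_smul, Finset.sum_add_distrib,
    ite_smul (p := _ = _), zero_smul, Finset.sum_ite_eq', Finset.mem_univ, if_true]

theorem isQuantumMatrix_iff {q : ℂ} (hq : q ≠ 0) (U : Fin n → Fin n → B) :
    IsQuantumMatrix q U ↔ rMatB B q n * twoLeg U = twoLeg U * rMatB B q n := by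
  have hq1 : q * q⁻¹ = 1 := mul_inv_cancel₀ hq
  have hq2 : q⁻¹ * q = 1 := inv_mul_cancel₀ hq
  constructor
  · intro h
    ext ⟨i, j⟩ ⟨k, l⟩
    rw [rMatB_mul_apply, mul_rMatB_apply]
    simp only [twoLeg, Prod.swap]
    rcases lt_trichotomy i j with hij | hij | hij <;> rcases lt_trichotomy k l with hkl | hkl | hkl
    · rw [if_neg hij.ne, if_neg hkl.ne, if_pos hij, if_pos hkl, h.comm _ _ _ _ hij hkl]
    · subst hkl
      rw [if_neg hij.ne, if_pos rfl, if_pos hij, if_neg (lt_irrefl _), h.col _ _ _ hij]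
      simp only [smul_smul, ← add_smul, sub_mul, hq2]
      congr 1; ring
    · rw [if_neg hij.ne, if_neg hkl.ne', if_pos hij, if_neg hkl.not_gt]
      have := h.cross _ _ _ _ hij hkl
      rw [sub_eq_iff_eq_add] at this
      rw [this]; simp [add_comm]
    · subst hij
      rw [if_pos rfl, if_neg hkl.ne, if_neg (lt_irrefl _), if_pos hkl, h.row _ _ _ hkl]
      simp only [smul_smul, ← add_smul, sub_mul, hq2]
      congr 1; ring
    · subst hij; subst hkl
      simp
    · subst hij
      rw [if_pos rfl, if_neg hkl.ne', if_neg (lt_irrefl _), if_neg hkl.not_gt, h.row _ _ _ hkl]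
      simp
    · rw [if_neg hij.ne', if_neg hkl.ne, if_neg hij.not_gt, if_pos hkl]
      have := h.cross _ _ _ _ hij hkl
      rw [sub_eq_iff_eq_add] at this
      rw [this, h.comm _ _ _ _ hij hkl]; simp [add_comm]
    · subst hkl
      rw [if_neg hij.ne', if_pos rfl, if_neg hij.not_gt, if_neg (lt_irrefl _), h.col _ _ _ hij]
      simp
    · rw [if_neg hij.ne', if_neg hkl.ne', if_neg hij.not_gt, if_neg hkl.not_gt,
        h.comm _ _ _ _ hij hkl]
  · intro h
    have key : ∀ i j k l, (if i = j then q else 1) • (U j k * U i l) +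
        (if i < j then q - q⁻¹ else 0) • (U i k * U j l) = (if k = l then q else 1) • (U i l * U j k)
        + (if k < l then q - q⁻¹ else 0) • (U i k * U j l) := by
      intro i j k l
      have := congrFun (congrFun h (i, j)) (k, l)
      rw [rMatB_mul_apply, mul_rMatB_apply] at this
      exact this
    refine ⟨?_, ?_, ?_, ?_⟩
    · intro i j k hij
      have := key j i k k
      rw [if_neg hij.ne', if_pos rfl, if_neg hij.not_gt, if_neg (lt_irrefl _)] at this
      simpa using this
    · intro k i j hij
      have := key k k j i
      rw [if_pos rfl, if_neg hij.ne', if_neg (lt_irrefl _), if_neg hij.not_gt] at this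
      simpa using this.symm
    · intro i j k l hij hkl
      have := key i j k l
      rw [if_neg hij.ne, if_neg hkl.ne, if_pos hij, if_pos hkl] at this
      simpa using this.symm
    · intro i j k l hij hkl
      have h1 := key i j l k
      rw [if_neg hij.ne, if_neg hkl.ne', if_pos hij, if_neg hkl.not_gt] at h1
      rw [sub_eq_iff_eq_add]
      simpa [add_comm] using h1.symm

lemma IsQuantumMatrix.mul {q : ℂ} (hq : q ≠ 0) {A A' : Fin n → Fin n → B}
    (hA : IsQuantumMatrix q A) (hA' : IsQuantumMatrix q A')
    (hc : ∀ i j k l, Commute (A i j) (A' k l)) :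
    IsQuantumMatrix q (fun i k => ∑ l, A i l * A' l k) := by
  have h : twoLeg (fun i k => ∑ l, A i l * A' l k) = twoLeg A * twoLeg A' := by
    ext ⟨i, j⟩ ⟨k, l⟩
    simp only [twoLeg, Matrix.mul_apply, Fintype.sum_prod_type, Finset.sum_mul_sum]
    refine Finset.sum_congr rfl fun a _ => Finset.sum_congr rfl fun b _ => ?_
    rw [mul_assoc, ← mul_assoc (A' a k), ← (hc j b a k).eq]
    simp only [mul_assoc]
  rw [isQuantumMatrix_iff hq] at hA hA' ⊢
  rw [h, ← mul_assoc, hA, mul_assoc, hA', mul_assoc]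

open MulOpposite in
/-- The transposed inverse of a quantum matrix is a quantum matrix over the opposite algebra. -/
lemma IsQuantumMatrix.op_inv {q : ℂ} (hq : q ≠ 0) {U V : Fin n → Fin n → B}
    (hU : IsQuantumMatrix q U) (h1 : ∀ i j, ∑ k, U i k * V j k = if i = j then 1 else 0)
    (h2 : ∀ i j, ∑ k, V k i * U k j = if i = j then 1 else 0) :
    IsQuantumMatrix q (fun i j => op (V i j)) := by
  let W : Matrix (Fin n × Fin n) (Fin n × Fin n) B := Matrix.of fun x y => V y.2 x.2 * V y.1 x.1
  have e1 : twoLeg U * W = 1 := by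
    ext ⟨i, j⟩ ⟨k, l⟩
    simp only [twoLeg, W, Matrix.mul_apply, Matrix.of_apply, Fintype.sum_prod_type, Matrix.one_apply, Prod.mk.injEq]
    have : ∀ a, ∑ b, U i a * U j b * (V l b * V k a) = U i a * (if j = l then 1 else 0) * V k a := by
      intro a
      rw [← h1 j l, Finset.mul_sum, Finset.sum_mul]
      simp only [mul_assoc]
    simp only [this]
    by_cases hjl : j = l
    · simp [hjl, h1]
    · simp [hjl]
  have e2 : W * twoLeg U = 1 := by
    ext ⟨i, j⟩ ⟨k, l⟩
    simp only [twoLeg, W, Matrix.mul_apply, Matrix.of_apply, Fintype.sum_prod_type, Matrix.one_apply, Prod.mk.injEq]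
    rw [Finset.sum_comm]
    have : ∀ b, ∑ a, V b j * V a i * (U a k * U b l) = V b j * (if i = k then 1 else 0) * U b l := by
      intro b
      rw [← h2 i k, Finset.mul_sum, Finset.sum_mul]
      simp only [mul_assoc]
    simp only [this]
    by_cases hik : i = k
    · simp [hik, h2]
    · simp [hik]
  rw [isQuantumMatrix_iff hq] at hU ⊢
  have e3 : W * rMatB B q n = rMatB B q n * W := by
    calc W * rMatB B q n = W * (rMatB B q n * twoLeg U) * W := by
          rw [mul_assoc, mul_assoc, e1, mul_one]
      _ = rMatB B q n * W := by rw [hU, ← mul_assoc, e2, one_mul]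
  ext x y
  have := congrArg op (congrFun (congrFun e3 y) x)
  rw [mul_rMatB_apply, rMatB_mul_apply] at this
  rw [mul_rMatB_apply, rMatB_mul_apply]
  simp only [W, twoLeg, Matrix.of_apply, op_add, op_smul, op_mul, Prod.swap] at this ⊢
  exact this

open MulOpposite in
lemma minor_op_inv {q : ℂ} (hq : q ≠ 0) {U V : Fin n → Fin n → B}
    (hU : IsQuantumMatrix q U) (h1 : ∀ i j, ∑ k, U i k * V j k = if i = j then 1 else 0)
    (ks : List (Fin n)) (I : Finset (Fin n)) :
    ∑ J : Finset (Fin n), minor q U I J * unop (minorAux q (fun l k => op (V k l)) ks J)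
      = algebraMap ℂ B (minorAux q (idMat n) ks I) := by
  induction ks generalizing I with
  | nil =>
    rw [Finset.sum_eq_single ∅]
    · simp only [minor, Finset.sort_empty, minorAux, if_true, unop_one, mul_one]
      split_ifs <;> simp
    · intro J _ hJ; simp [minorAux, hJ]
    · simp
  | cons k t ih =>
    have s1 : ∀ J : Finset (Fin n),
        minor q U I J * unop (minorAux q (fun l k => op (V k l)) (k :: t) J)
        = ∑ l ∈ J, minor q U I (insert l (J.erase l)) * ((-q) ^ rk (J.erase l) l •
            (unop (minorAux q (fun l k => op (V k l)) t (J.erase l)) * V k l)) := by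
      intro J
      rw [minorAux, unop_sum, Finset.mul_sum]
      refine Finset.sum_congr rfl fun l hl => ?_
      rw [Finset.insert_erase hl, rk_erase_le le_rfl]
      simp
    rw [Finset.sum_congr rfl fun J _ => s1 J]
    rw [← sum_insert_erase (fun l J => minor q U I (insert l J) * ((-q) ^ rk J l •
            (unop (minorAux q (fun l k => op (V k l)) t J) * V k l)))]
    have s2 : ∀ (J : Finset (Fin n)) (l : Fin n),
        (if l ∈ J then 0 else minor q U I (insert l J) * ((-q) ^ rk J l •
            (unop (minorAux q (fun l k => op (V k l)) t J) * V k l)))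
        = ∑ i ∈ I, (-q) ^ rk I i • (U i l * (minor q U (I.erase i) J *
            unop (minorAux q (fun l k => op (V k l)) t J)) * V k l) := by
      intro J l
      have := minorAux_cons_sort hq hU l J I
      rw [minorAux] at this
      have h3 : (∑ i ∈ I, (-q) ^ rk I i • (U i l * (minor q U (I.erase i) J *
            unop (minorAux q (fun l k => op (V k l)) t J)) * V k l))
          = (∑ i ∈ I, (-q) ^ rk I i • (U i l * minorAux q U (J.sort (· ≤ ·)) (I.erase i))) *
            (unop (minorAux q (fun l k => op (V k l)) t J) * V k l) := by
        rw [Finset.sum_mul]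
        refine Finset.sum_congr rfl fun i _ => ?_
        simp only [minor, mul_assoc, smul_mul_assoc]
      rw [h3, this]
      split_ifs
      · simp
      · rw [mul_smul_comm, smul_mul_assoc]
    simp only [s2]
    rw [Finset.sum_comm]
    have s3 : ∀ l : Fin n, ∑ J : Finset (Fin n), ∑ i ∈ I, (-q) ^ rk I i • (U i l *
        (minor q U (I.erase i) J * unop (minorAux q (fun l k => op (V k l)) t J)) * V k l)
        = ∑ i ∈ I, ((-q) ^ rk I i * minorAux q (idMat n) t (I.erase i)) • (U i l * V k l) := by
      intro l
      rw [Finset.sum_comm]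
      refine Finset.sum_congr rfl fun i _ => ?_
      rw [← Finset.smul_sum, ← Finset.sum_mul, ← Finset.mul_sum, ih, mul_smul,
        ← Algebra.commutes, mul_assoc, ← Algebra.smul_def]
    rw [Finset.sum_congr rfl fun l _ => s3 l, Finset.sum_comm, minorAux, map_sum]
    refine Finset.sum_congr rfl fun i _ => ?_
    rw [← Finset.smul_sum, h1, idMat]
    split_ifs
    · rw [Algebra.smul_def, mul_one, one_mul, smul_eq_mul]
    · simp

open MulOpposite in
lemma qdet_op_inv {q : ℝ} (hq : q ≠ 0) {U V : Fin n → Fin n → B}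
    (hU : IsQuantumMatrix (q : ℂ) U) (h1 : ∀ i j, ∑ k, U i k * V j k = if i = j then 1 else 0)
    (h2 : ∀ i j, ∑ k, V k i * U k j = if i = j then 1 else 0) (hd : qdet (q : ℂ) U = 1) :
    qdet (q : ℂ) (fun i j => op (V i j)) = 1 := by
  have hqc : (q : ℂ) ≠ 0 := by exact_mod_cast hq
  have h := minor_op_inv hqc hU h1 (univ.sort (· ≤ ·)) univ
  rw [Finset.sum_eq_single univ, minorAux_idMat _ _ (pairwise_sort' _)] at h
  · rw [← qdet_eq_minor, hd, one_mul] at h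
    have h3 := minor_transpose hq (hU.op_inv hqc h1 h2) univ univ
    rw [qdet_eq_minor, ← h3, minor]
    apply unop_injective
    rw [h]; simp
  · intro J _ hJ
    rw [minor, minorAux_eq_zero (ks := J.sort (· ≤ ·)), zero_mul]
    rw [Finset.length_sort]
    exact fun h => hJ ((Finset.card_eq_iff_eq_univ J).1 (by simpa using h))
  · simp

lemma qdet_mul {q : ℂ} (hq : q ≠ 0) {A A' : Fin n → Fin n → B}
    (hA : IsQuantumMatrix q A) (hc : ∀ i j k l, Commute (A i j) (A' k l)) :
    qdet q (fun i k => ∑ l, A i l * A' l k) = qdet q A * qdet q A' := by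
  simp only [qdet_eq_minor, minor_mul_univ hq hA hc]

lemma qdet_map {C : Type*} [Ring C] [Algebra ℂ C] (f : B →ₐ[ℂ] C) (q : ℂ)
    (U : Fin n → Fin n → B) : f (qdet q U) = qdet q (fun i j => f (U i j)) := by
  simp only [qdet_eq_minor, minor, minorAux_map]

end Minors

section CoordinateAlgebra

/-! ### The coordinate algebra of quantum `SU(N)` -/

/-- The defining relations of `O(SU_q(N))`: the quadratic relations of `O(M_q(N))`, and quantum
determinant one. -/
inductive SURel (q : ℝ) (N : ℕ) :
    FreeAlgebra ℂ (Fin N × Fin N) → FreeAlgebra ℂ (Fin N × Fin N) → Prop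
  | col (i j k : Fin N) (h : i < j) : SURel q N
      (FreeAlgebra.ι ℂ (i, k) * FreeAlgebra.ι ℂ (j, k))
      ((q : ℂ) • (FreeAlgebra.ι ℂ (j, k) * FreeAlgebra.ι ℂ (i, k)))
  | row (k i j : Fin N) (h : i < j) : SURel q N
      (FreeAlgebra.ι ℂ (k, i) * FreeAlgebra.ι ℂ (k, j))
      ((q : ℂ) • (FreeAlgebra.ι ℂ (k, j) * FreeAlgebra.ι ℂ (k, i)))
  | comm (i j k l : Fin N) (h : i < j) (h' : k < l) : SURel q N
      (FreeAlgebra.ι ℂ (i, l) * FreeAlgebra.ι ℂ (j, k))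
      (FreeAlgebra.ι ℂ (j, k) * FreeAlgebra.ι ℂ (i, l))
  | cross (i j k l : Fin N) (h : i < j) (h' : k < l) : SURel q N
      (FreeAlgebra.ι ℂ (i, k) * FreeAlgebra.ι ℂ (j, l)
        - FreeAlgebra.ι ℂ (j, l) * FreeAlgebra.ι ℂ (i, k))
      (((q : ℂ) - (q : ℂ)⁻¹) • (FreeAlgebra.ι ℂ (i, l) * FreeAlgebra.ι ℂ (j, k)))
  | det : SURel q N (qdet (q : ℂ) (fun i j => FreeAlgebra.ι ℂ (i, j))) 1

/-- The coordinate algebra `O(SU_q(N))` with `N = ℓ + 1` and `0 < q < 1`: the universal unital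
`ℂ`-algebra on the generators `u_{ij}` with the defining relations `SURel`. Its involution, given by
`u_{ij}^* = S(u_{ji})`, is constructed below. -/
def SUq (q : Set.Ioo (0 : ℝ) 1) (ℓ : ℕ) : Type := RingQuot (SURel q (ℓ + 1))

variable (q : Set.Ioo (0 : ℝ) 1) (ℓ : ℕ)

instance : Ring (SUq q ℓ) := inferInstanceAs (Ring (RingQuot (SURel q (ℓ + 1))))
instance : Algebra ℂ (SUq q ℓ) := inferInstanceAs (Algebra ℂ (RingQuot (SURel q (ℓ + 1))))

/-- The quotient map from the free algebra. -/
def SUq.mk : FreeAlgebra ℂ (Fin (ℓ + 1) × Fin (ℓ + 1)) →ₐ[ℂ] SUq q ℓ :=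
  RingQuot.mkAlgHom ℂ (SURel q (ℓ + 1))

variable {q ℓ}

lemma q_ne_zero (q : Set.Ioo (0 : ℝ) 1) : (q : ℝ) ≠ 0 := q.2.1.ne'
lemma qc_ne_zero (q : Set.Ioo (0 : ℝ) 1) : ((q : ℝ) : ℂ) ≠ 0 := by
  exact_mod_cast q_ne_zero q

/-- The generators `u_{ij}`, the entries of the fundamental unitary. -/
def u (i j : Fin (ℓ + 1)) : SUq q ℓ := SUq.mk q ℓ (FreeAlgebra.ι ℂ (i, j))

lemma SUq.mk_rel {x y : FreeAlgebra ℂ (Fin (ℓ + 1) × Fin (ℓ + 1))} (h : SURel q (ℓ + 1) x y) :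
    SUq.mk q ℓ x = SUq.mk q ℓ y := RingQuot.mkAlgHom_rel ℂ h

lemma SUq.mk_surjective : Function.Surjective (SUq.mk q ℓ) :=
  RingQuot.mkAlgHom_surjective ℂ (SURel q (ℓ + 1))

theorem isQuantumMatrix_u :
    IsQuantumMatrix ((q : ℝ) : ℂ) (u : Fin (ℓ + 1) → Fin (ℓ + 1) → SUq q ℓ) where
  col i j k h := by
    have := SUq.mk_rel (SURel.col (q := q) i j k h)
    rwa [map_smul, map_mul, map_mul] at this
  row i j k h := by
    have := SUq.mk_rel (SURel.row (q := q) i j k h)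
    rwa [map_smul, map_mul, map_mul] at this
  comm i j k l h h' := by simpa [u] using SUq.mk_rel (SURel.comm (q := q) i j k l h h')
  cross i j k l h h' := by simpa [u] using SUq.mk_rel (SURel.cross (q := q) i j k l h h')

theorem qdet_u : qdet ((q : ℝ) : ℂ) (u : Fin (ℓ + 1) → Fin (ℓ + 1) → SUq q ℓ) = 1 := by
  have := SUq.mk_rel (SURel.det (q := q) (N := ℓ + 1))
  rwa [qdet_map, map_one] at this

theorem SUq.induction {P : SUq q ℓ → Prop} (h1 : ∀ c : ℂ, P (algebraMap ℂ _ c))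
    (h2 : ∀ i j, P (u i j)) (h3 : ∀ x y, P x → P y → P (x + y))
    (h4 : ∀ x y, P x → P y → P (x * y)) (x : SUq q ℓ) : P x := by
  obtain ⟨x, rfl⟩ := SUq.mk_surjective x
  induction x using FreeAlgebra.induction with
  | grade0 c => rw [AlgHom.commutes]; exact h1 c
  | grade1 p => exact h2 p.1 p.2
  | mul a b ha hb => rw [map_mul]; exact h4 _ _ ha hb
  | add a b ha hb => rw [map_add]; exact h3 _ _ ha hb

lemma SURel.lift_eq {q : ℝ} {N : ℕ} {B : Type*} [Ring B] [Algebra ℂ B] (U : Fin N → Fin N → B)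
    (hU : IsQuantumMatrix (q : ℂ) U) (hd : qdet (q : ℂ) U = 1)
    {x y : FreeAlgebra ℂ (Fin N × Fin N)} (h : SURel q N x y) :
    FreeAlgebra.lift ℂ (fun p => U p.1 p.2) x = FreeAlgebra.lift ℂ (fun p => U p.1 p.2) y := by
  induction h with
  | col i j k h =>
    rw [map_smul, map_mul, map_mul]; simpa only [FreeAlgebra.lift_ι_apply] using hU.col i j k h
  | row i j k h =>
    rw [map_smul, map_mul, map_mul]; simpa only [FreeAlgebra.lift_ι_apply] using hU.row i j k h
  | comm i j k l h h' => simpa using hU.comm i j k l h h'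
  | cross i j k l h h' => simpa using hU.cross i j k l h h'
  | det => rw [qdet_map, map_one]; simpa using hd

/-- The universal property of `O(SU_q(N))`. -/
def SUq.lift {B : Type*} [Ring B] [Algebra ℂ B] (U : Fin (ℓ + 1) → Fin (ℓ + 1) → B)
    (hU : IsQuantumMatrix ((q : ℝ) : ℂ) U) (hd : qdet ((q : ℝ) : ℂ) U = 1) : SUq q ℓ →ₐ[ℂ] B :=
  RingQuot.liftAlgHom ℂ ⟨FreeAlgebra.lift ℂ (fun p => U p.1 p.2),
    fun _ _ h => SURel.lift_eq U hU hd h⟩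

@[simp] lemma SUq.lift_u {B : Type*} [Ring B] [Algebra ℂ B] (U : Fin (ℓ + 1) → Fin (ℓ + 1) → B)
    (hU : IsQuantumMatrix ((q : ℝ) : ℂ) U) (hd : qdet ((q : ℝ) : ℂ) U = 1) (i j : Fin (ℓ + 1)) :
    SUq.lift (q := q) U hU hd (u i j) = U i j := by
  have := RingQuot.liftAlgHom_mkAlgHom_apply ℂ (FreeAlgebra.lift ℂ (fun p => U p.1 p.2))
    (s := SURel q (ℓ + 1)) (fun _ _ h => SURel.lift_eq U hU hd h) (FreeAlgebra.ι ℂ (i, j))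
  rw [FreeAlgebra.lift_ι_apply] at this
  exact this

/-- The values `u_{ij}^* = S(u_{ji})` of the involution on the generators: a cofactor. -/
def uStar (i j : Fin (ℓ + 1)) : SUq q ℓ := cofactor ((q : ℝ) : ℂ) u j i

lemma sum_u_uStar (i j : Fin (ℓ + 1)) :
    ∑ k, u i k * uStar j k = if i = j then (1 : SUq q ℓ) else 0 := by
  rw [← qdet_u]; exact mul_cofactor (q_ne_zero q) isQuantumMatrix_u i j

lemma sum_uStar_u (i j : Fin (ℓ + 1)) :
    ∑ k, uStar k i * u k j = if i = j then (1 : SUq q ℓ) else 0 := by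
  rw [← qdet_u]; exact cofactor_mul (qc_ne_zero q) isQuantumMatrix_u i j

open MulOpposite

/-- The opposite algebra, with `ℂ` acting through complex conjugation. -/
def ConjOp (q : Set.Ioo (0 : ℝ) 1) (ℓ : ℕ) : Type := (SUq q ℓ)ᵐᵒᵖ

instance : Ring (ConjOp q ℓ) := inferInstanceAs (Ring (SUq q ℓ)ᵐᵒᵖ)

/-- The identity map. -/
def toConjOp : (SUq q ℓ)ᵐᵒᵖ ≃+* ConjOp q ℓ := RingEquiv.refl _

instance : Algebra ℂ (ConjOp q ℓ) :=
  (toConjOp.toRingHom.comp ((algebraMap ℂ (SUq q ℓ)ᵐᵒᵖ).comp (starRingEnd ℂ))).toAlgebra'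
    (fun c x => Algebra.commutes (A := (SUq q ℓ)ᵐᵒᵖ) (starRingEnd ℂ c) x)

/-- The conjugate linear, antimultiplicative map on the free algebra inducing the involution. -/
def preStar : FreeAlgebra ℂ (Fin (ℓ + 1) × Fin (ℓ + 1)) →+* (SUq q ℓ)ᵐᵒᵖ :=
  toConjOp.symm.toRingHom.comp
    (FreeAlgebra.lift ℂ (A := ConjOp q ℓ) (fun p => toConjOp (op (uStar p.1 p.2)))).toRingHom

lemma preStar_ι (i j : Fin (ℓ + 1)) :
    preStar (q := q) (FreeAlgebra.ι ℂ (i, j)) = op (uStar i j) := by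
  have := FreeAlgebra.lift_ι_apply (R := ℂ) (A := ConjOp q ℓ)
    (fun p => toConjOp (op (uStar p.1 p.2))) (i, j)
  exact congrArg toConjOp.symm this

lemma preStar_smul (c : ℂ) (x : FreeAlgebra ℂ (Fin (ℓ + 1) × Fin (ℓ + 1))) :
    preStar (q := q) (c • x) = starRingEnd ℂ c • preStar (q := q) x := by
  rw [Algebra.smul_def, map_mul, Algebra.smul_def]
  congr 1
  have := (FreeAlgebra.lift ℂ (A := ConjOp q ℓ)
    (fun p : Fin (ℓ + 1) × Fin (ℓ + 1) => toConjOp (op (uStar p.1 p.2)))).commutes c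
  exact congrArg toConjOp.symm this

lemma preStar_qdet :
    preStar (q := q) (qdet ((q : ℝ) : ℂ) (fun i j : Fin (ℓ + 1) => FreeAlgebra.ι ℂ (i, j)))
      = qdet ((q : ℝ) : ℂ) (fun i j => op (uStar i j)) := by
  unfold qdet
  rw [map_sum]
  refine Finset.sum_congr rfl fun σ _ => ?_
  rw [preStar_smul, map_list_prod, List.map_ofFn]
  congr 1
  · simp
  · congr 2
    ext j
    simp [preStar_ι]

lemma isQuantumMatrix_uStar :
    IsQuantumMatrix ((q : ℝ) : ℂ) (fun i j => op (uStar (q := q) (ℓ := ℓ) i j)) :=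
  isQuantumMatrix_u.op_inv (qc_ne_zero q) sum_u_uStar sum_uStar_u

lemma qdet_uStar : qdet ((q : ℝ) : ℂ) (fun i j => op (uStar (q := q) (ℓ := ℓ) i j)) = 1 :=
  qdet_op_inv (q_ne_zero q) isQuantumMatrix_u sum_u_uStar sum_uStar_u qdet_u

lemma preStar_rel {x y : FreeAlgebra ℂ (Fin (ℓ + 1) × Fin (ℓ + 1))} (h : SURel q (ℓ + 1) x y) :
    preStar (q := q) x = preStar (q := q) y := by
  induction h with
  | col i j k h =>
    rw [preStar_smul, map_mul, map_mul, preStar_ι, preStar_ι, Complex.conj_ofReal]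
    exact isQuantumMatrix_uStar.col i j k h
  | row i j k h =>
    rw [preStar_smul, map_mul, map_mul, preStar_ι, preStar_ι, Complex.conj_ofReal]
    exact isQuantumMatrix_uStar.row i j k h
  | comm i j k l h h' =>
    rw [map_mul, map_mul, preStar_ι, preStar_ι]
    exact isQuantumMatrix_uStar.comm i j k l h h'
  | cross i j k l h h' =>
    rw [preStar_smul, map_sub, map_mul, map_mul, map_mul, preStar_ι, preStar_ι, preStar_ι,
      preStar_ι, map_sub, map_inv₀, Complex.conj_ofReal]
    exact isQuantumMatrix_uStar.cross i j k l h h'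
  | det => rw [preStar_qdet, map_one, qdet_uStar]

/-- The involution, as a ring homomorphism to the opposite ring. -/
def starHom : SUq q ℓ →+* (SUq q ℓ)ᵐᵒᵖ :=
  RingQuot.lift ⟨preStar, fun _ _ h => preStar_rel h⟩

lemma starHom_mk (x : FreeAlgebra ℂ (Fin (ℓ + 1) × Fin (ℓ + 1))) :
    starHom (SUq.mk q ℓ x) = preStar x := by
  have := RingQuot.lift_mkRingHom_apply (preStar (q := q) (ℓ := ℓ))
    (r := SURel q (ℓ + 1)) (fun _ _ h => preStar_rel h) x
  rw [← this, ← RingQuot.mkAlgHom_coe ℂ]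
  rfl

lemma starHom_u (i j : Fin (ℓ + 1)) : starHom (u (q := q) i j) = op (uStar i j) := by
  rw [u, starHom_mk, preStar_ι]

lemma starHom_smul (c : ℂ) (x : SUq q ℓ) : starHom (c • x) = starRingEnd ℂ c • starHom x := by
  obtain ⟨x, rfl⟩ := SUq.mk_surjective x
  rw [← map_smul, starHom_mk, starHom_mk, preStar_smul]

lemma starHom_uStar (i j : Fin (ℓ + 1)) : starHom (uStar (q := q) i j) = op (u i j) := by
  have hc : starHom (uStar (q := q) i j)
      = cofactor ((q : ℝ) : ℂ) (fun i j => op (uStar (q := q) (ℓ := ℓ) i j)) j i := by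
    unfold uStar cofactor qdet
    rw [starHom_smul, map_sum]
    congr 1
    · simp
    · refine Finset.sum_congr rfl fun σ _ => ?_
      rw [starHom_smul, map_list_prod, List.map_ofFn]
      congr 1
      · simp
      · congr 2
        ext j
        simp [starHom_u, uStar, cofactor, qdet]
  rw [hc]
  have h1 := cofactor_mul (qc_ne_zero q) (isQuantumMatrix_uStar (q := q) (ℓ := ℓ))
  rw [qdet_uStar] at h1
  have h2 : ∀ k l : Fin (ℓ + 1), ∑ m, op (uStar (q := q) k m) * op (u l m)
      = if k = l then 1 else 0 := by
    intro k l
    have := congrArg op (sum_u_uStar (q := q) l k)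
    simp only [op_sum, op_mul] at this
    rw [this]
    by_cases h : k = l
    · simp [h]
    · simp [h, Ne.symm h]
  set C := cofactor ((q : ℝ) : ℂ) (fun i j => op (uStar (q := q) (ℓ := ℓ) i j)) with hC
  calc C j i = ∑ k, C j k * (if k = i then 1 else 0) := by simp
    _ = ∑ k, C j k * ∑ m, op (uStar (q := q) k m) * op (u i m) := by simp only [h2]
    _ = ∑ m, (∑ k, C j k * op (uStar (q := q) k m)) * op (u i m) := by
        simp only [Finset.mul_sum, Finset.sum_mul, mul_assoc]
        rw [Finset.sum_comm]
    _ = op (u i j) := by simp [h1]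

instance : Star (SUq q ℓ) := ⟨fun x => unop (starHom x)⟩

lemma SUq.star_def (x : SUq q ℓ) : star x = unop (starHom x) := rfl

instance : StarRing (SUq q ℓ) where
  star_add x y := by simp [SUq.star_def]
  star_mul x y := by simp [SUq.star_def]
  star_involutive x := by
    induction x using SUq.induction with
    | h1 c => simp [SUq.star_def, Algebra.algebraMap_eq_smul_one, starHom_smul]
    | h2 i j => rw [SUq.star_def, SUq.star_def, starHom_u, unop_op, starHom_uStar, unop_op]
    | h3 x y hx hy => simp only [SUq.star_def, map_add, unop_add] at *; rw [hx, hy]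
    | h4 x y hx hy => simp only [SUq.star_def, map_mul, unop_mul] at *; rw [hx, hy]

instance : StarModule ℂ (SUq q ℓ) where
  star_smul c x := by simp [SUq.star_def, starHom_smul]

theorem star_u (i j : Fin (ℓ + 1)) : star (u (q := q) i j) = cofactor ((q : ℝ) : ℂ) u j i := by
  rw [SUq.star_def, starHom_u]; rfl

theorem sum_u_star_u (i j : Fin (ℓ + 1)) :
    ∑ k, u i k * star (u j k) = if i = j then (1 : SUq q ℓ) else 0 := by
  simp only [star_u]; exact sum_u_uStar i j

theorem sum_star_u_u (i j : Fin (ℓ + 1)) :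
    ∑ k, star (u k i) * u k j = if i = j then (1 : SUq q ℓ) else 0 := by
  simp only [star_u]; exact sum_uStar_u i j

open scoped TensorProduct in
/-- The coproduct, `Δ(u_{ij}) = ∑_k u_{ik} ⊗ u_{kj}`. -/
def comul : SUq q ℓ →ₐ[ℂ] SUq q ℓ ⊗[ℂ] SUq q ℓ :=
  SUq.lift (fun i j => ∑ k, u i k ⊗ₜ[ℂ] u k j)
    (by
      have hA := (isQuantumMatrix_u (q := q) (ℓ := ℓ)).map
        (Algebra.TensorProduct.includeLeft (R := ℂ) (S := ℂ) (A := SUq q ℓ) (B := SUq q ℓ))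
      have hA' := (isQuantumMatrix_u (q := q) (ℓ := ℓ)).map
        (Algebra.TensorProduct.includeRight (R := ℂ) (A := SUq q ℓ) (B := SUq q ℓ))
      have := hA.mul (qc_ne_zero q) hA' (fun i j k l => by simp [Commute, SemiconjBy])
      simpa using this)
    (by
      have hA := (isQuantumMatrix_u (q := q) (ℓ := ℓ)).map
        (Algebra.TensorProduct.includeLeft (R := ℂ) (S := ℂ) (A := SUq q ℓ) (B := SUq q ℓ))
      have := qdet_mul (qc_ne_zero q) hA
        (A' := fun i j => Algebra.TensorProduct.includeRight (R := ℂ) (A := SUq q ℓ)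
          (B := SUq q ℓ) (u i j)) (fun i j k l => by simp [Commute, SemiconjBy])
      rw [← qdet_map, ← qdet_map, qdet_u, map_one, map_one, one_mul] at this
      simpa using this)

open scoped TensorProduct in
lemma comul_u (i j : Fin (ℓ + 1)) : comul (u (q := q) i j) = ∑ k, u i k ⊗ₜ[ℂ] u k j :=
  SUq.lift_u _ _ _ i j

/-- The upper triangular matrix with diagonal `δ_{ij} w_i⁻¹`, `δ_{ij} w_i` and upper right entry
`δ_{ia} δ_{jb}`. -/
def skewMat {N : ℕ} (w : Fin N → ℂ) (a b i j : Fin N) : Matrix (Fin 2) (Fin 2) ℂ :=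
  !![if i = j then (w i)⁻¹ else 0, if i = a ∧ j = b then 1 else 0; 0, if i = j then w i else 0]

lemma qdet_skewMat {N : ℕ} (q : ℂ) (w : Fin N → ℂ) (a b : Fin N) (hab : a ≠ b)
    (hw : ∏ j, w j = 1) : qdet q (skewMat w a b) = 1 := by
  unfold qdet
  rw [Finset.sum_eq_single 1]
  · have h1 : inversions (1 : Equiv.Perm (Fin N)) = 0 := by
      unfold inversions
      rw [Finset.card_eq_zero, Finset.filter_eq_empty_iff]
      rintro p _ ⟨h, h'⟩
      exact lt_asymm h h'
    have h2 : (fun j => skewMat w a b ((1 : Equiv.Perm (Fin N)) j) j)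
        = fun j => Matrix.diagonalRingHom (Fin 2) ℂ ![(w j)⁻¹, w j] := by
      funext j
      have : ¬ (j = a ∧ j = b) := fun h => hab (h.1.symm.trans h.2)
      ext x y
      fin_cases x <;> fin_cases y <;> simp [skewMat, this]
    rw [h1, h2, pow_zero, one_smul]
    have h4 : (List.ofFn fun j => Matrix.diagonalRingHom (Fin 2) ℂ ![(w j)⁻¹, w j])
      = List.map (Matrix.diagonalRingHom (Fin 2) ℂ) (List.ofFn fun j => ![(w j)⁻¹, w j]) := by
      rw [List.map_ofFn]; rfl
    rw [h4, ← map_list_prod, List.prod_ofFn]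
    have h5 : (∏ j, ![(w j)⁻¹, w j]) = 1 := by
      ext x
      rw [Finset.prod_apply]
      fin_cases x <;> simp [hw]
    rw [h5, map_one]
  · intro σ _ hσ
    have : ∃ j, σ j ≠ j ∧ ¬ (σ j = a ∧ j = b) := by
      by_contra! hcon
      apply hσ
      ext j : 1
      by_contra hj
      have h1 := hcon j hj
      have h2 := hcon (σ j) (fun h => hj (σ.injective h))
      exact hj (h2.2.trans h1.2.symm)
    obtain ⟨j, hj1, hj2⟩ := this
    rw [List.prod_eq_zero, smul_zero]
    rw [List.mem_ofFn]
    refine ⟨j, ?_⟩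
    ext x y
    fin_cases x <;> fin_cases y <;> simp [skewMat, hj1, hj2]
  · simp

lemma skewMat_mul {N : ℕ} (w : Fin N → ℂ) (a b i j k l : Fin N) :
    skewMat w a b i j * skewMat w a b k l =
    !![(if i = j then (w i)⁻¹ else 0) * (if k = l then (w k)⁻¹ else 0),
      (if i = j then (w i)⁻¹ else 0) * (if k = a ∧ l = b then 1 else 0) +
        (if i = a ∧ j = b then 1 else 0) * (if k = l then w k else 0);
      0, (if i = j then w i else 0) * (if k = l then w k else 0)] := by
  ext x y
  fin_cases x <;> fin_cases y <;> simp [skewMat, Matrix.mul_apply, Fin.sum_univ_two]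

lemma isQuantumMatrix_skewMat {N : ℕ} {q : ℂ} (hq : q ≠ 0) (w : Fin N → ℂ) (a b : Fin N)
    (hab : b.val + 1 = a.val) (hwa : (w a) ^ 2 = q) (hwb : (w b) ^ 2 = q⁻¹)
    (hw : ∀ i : Fin N, i.val ≠ a.val → i.val ≠ b.val → w i = 1) :
    IsQuantumMatrix q (skewMat w a b) := by
  have hwa0 : w a ≠ 0 := by rintro h; rw [h] at hwa; simp at hwa; exact hq hwa.symm
  have hwb0 : w b ≠ 0 := by rintro h; rw [h] at hwb; simp at hwb; exact hq hwb.symm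
  have e1 : (w b)⁻¹ = q * w b := by field_simp; rw [hwb]; field_simp
  have e2 : w a = q * (w a)⁻¹ := by field_simp; exact hwa
  refine ⟨?_, ?_, ?_, ?_⟩
  · intro i j k h
    rw [skewMat_mul, skewMat_mul]
    ext x y
    fin_cases x <;> fin_cases y <;> simp [Fin.ext_iff] <;> split_ifs <;> grind
  · intro k i j h
    rw [skewMat_mul, skewMat_mul]
    ext x y
    fin_cases x <;> fin_cases y <;> simp [Fin.ext_iff]  <;> split_ifs <;> grind
  · intro i j k l h h'
    rw [skewMat_mul, skewMat_mul]
    ext x y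
    fin_cases x <;> fin_cases y <;> simp [Fin.ext_iff] <;> split_ifs <;> grind
  · intro i j k l h h'
    rw [skewMat_mul, skewMat_mul, skewMat_mul]
    ext x y
    fin_cases x <;> fin_cases y <;> simp [Fin.ext_iff] <;> split_ifs <;> grind

lemma skewMat_transpose {N : ℕ} (w : Fin N → ℂ) (a b i j : Fin N) :
    skewMat w b a i j = skewMat w a b j i := by
  unfold skewMat
  by_cases h : i = j
  · subst h; simp [and_comm]
  · simp [h, Ne.symm h, and_comm]

/-- The number `q^{1/2}`. -/
def sq (q : Set.Ioo (0 : ℝ) 1) : ℂ := ((Real.sqrt q : ℝ) : ℂ)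

lemma sq_sq (q : Set.Ioo (0 : ℝ) 1) : sq q ^ 2 = ((q : ℝ) : ℂ) := by
  unfold sq
  exact_mod_cast Real.sq_sqrt q.2.1.le

lemma sq_ne_zero (q : Set.Ioo (0 : ℝ) 1) : sq q ≠ 0 := by
  intro h
  have := sq_sq q
  rw [h] at this
  exact qc_ne_zero q (by simpa using this.symm)

variable (q)

/-- The diagonal of `π(K_r)`, where `π` is the fundamental representation of `U_q(su(N))`. Here
`r : Fin ℓ` is a simple root; the indices `r` and `r + 1` of `ℂ^N` are `r.castSucc` and `r.succ`. -/
def kWeight (r : Fin ℓ) (j : Fin (ℓ + 1)) : ℂ :=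
  if j = r.succ then sq q else if j = r.castSucc then (sq q)⁻¹ else 1

lemma prod_kWeight (r : Fin ℓ) : ∏ j, kWeight q r j = 1 := by
  have h : ∀ j, kWeight q r j = (if j = r.succ then sq q else 1) *
      (if j = r.castSucc then (sq q)⁻¹ else 1) := by
    intro j
    unfold kWeight
    by_cases h1 : j = r.succ
    · have : r.succ ≠ r.castSucc := Fin.castSucc_lt_succ.ne'
      subst h1; simp [this]
    · simp [h1]
  simp only [h, Finset.prod_mul_distrib, Finset.prod_ite_eq', Finset.mem_univ, if_true]
  exact mul_inv_cancel₀ (sq_ne_zero q)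

lemma isQuantumMatrix_E (r : Fin ℓ) :
    IsQuantumMatrix ((q : ℝ) : ℂ) (skewMat (kWeight q r) r.succ r.castSucc) := by
  have hne : r.castSucc ≠ r.succ := Fin.castSucc_lt_succ.ne
  refine isQuantumMatrix_skewMat (qc_ne_zero q) _ _ _ (by simp) ?_ ?_ ?_
  · simp [kWeight, sq_sq]
  · simp [kWeight, hne, sq_sq]
  · intro i h1 h2
    rw [kWeight, if_neg (fun h => h1 (congrArg _ h)), if_neg (fun h => h2 (congrArg _ h))]

/-- The dual pairing of `U_q(su(N))` and `O(SU_q(N))` with `K_r`, `K_r⁻¹` and `E_r`, as the algebra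
homomorphism `x ↦ !![⟨K_r⁻¹, x⟩, ⟨E_r, x⟩; 0, ⟨K_r, x⟩]`. It is multiplicative, because
`Δ(K_r) = K_r ⊗ K_r` and `Δ(E_r) = E_r ⊗ K_r + K_r⁻¹ ⊗ E_r`, and it is determined by the values
`⟨η, u_{ij}⟩ = π_{ij}(η)`, with `π(E_r) = e_{r+1,r}`. -/
def pairE (r : Fin ℓ) : SUq q ℓ →ₐ[ℂ] Matrix (Fin 2) (Fin 2) ℂ :=
  SUq.lift (skewMat (kWeight q r) r.succ r.castSucc) (isQuantumMatrix_E q r)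
    (qdet_skewMat _ _ _ _ Fin.castSucc_lt_succ.ne' (prod_kWeight q r))

/-- The dual pairing with `K_r` and `F_r = E_r^*`, as the algebra homomorphism
`x ↦ !![⟨K_r⁻¹, x⟩, ⟨F_r, x⟩; 0, ⟨K_r, x⟩]`; here `π(F_r) = e_{r,r+1}`. -/
def pairF (r : Fin ℓ) : SUq q ℓ →ₐ[ℂ] Matrix (Fin 2) (Fin 2) ℂ :=
  SUq.lift (skewMat (kWeight q r) r.castSucc r.succ)
    (by
      have := (isQuantumMatrix_E q r).transpose
      simpa only [← skewMat_transpose] using this)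
    (qdet_skewMat _ _ _ _ Fin.castSucc_lt_succ.ne (prod_kWeight q r))

variable {q}

/-! ### The action of the quantized enveloping algebra

The left action `d` of `U_q(su(N))` on `O(SU_q(N))` is `d_η = (⟨S⁻¹(η), ·⟩ ⊗ 1)Δ`. It is an algebra
homomorphism `U_q(su(N)) → End(O(SU_q(N)))`. On the generators, `S⁻¹(K_r) = K_r⁻¹`,
`S⁻¹(E_r) = -q⁻¹ E_r` and `S⁻¹(F_r) = -q F_r`. -/

open scoped TensorProduct in
/-- The operator `(f ⊗ 1)Δ`. -/
def contract (f : SUq q ℓ →ₗ[ℂ] ℂ) : Module.End ℂ (SUq q ℓ) :=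
  (TensorProduct.lid ℂ (SUq q ℓ)).toLinearMap ∘ₗ f.rTensor (SUq q ℓ) ∘ₗ comul.toLinearMap

/-- `d_{K_r} = (⟨K_r⁻¹, ·⟩ ⊗ 1)Δ`. -/
def dK (r : Fin ℓ) : Module.End ℂ (SUq q ℓ) :=
  contract (Matrix.entryLinearMap ℂ ℂ 0 0 ∘ₗ (pairE q r).toLinearMap)

/-- `d_{K_r⁻¹} = (⟨K_r, ·⟩ ⊗ 1)Δ`. -/
def dKinv (r : Fin ℓ) : Module.End ℂ (SUq q ℓ) :=
  contract (Matrix.entryLinearMap ℂ ℂ 1 1 ∘ₗ (pairE q r).toLinearMap)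

/-- `d_{E_r} = -q⁻¹ (⟨E_r, ·⟩ ⊗ 1)Δ`. -/
def dE (r : Fin ℓ) : Module.End ℂ (SUq q ℓ) :=
  (-((q : ℝ) : ℂ)⁻¹) • contract (Matrix.entryLinearMap ℂ ℂ 0 1 ∘ₗ (pairE q r).toLinearMap)

/-- `d_{F_r} = -q (⟨F_r, ·⟩ ⊗ 1)Δ`. -/
def dF (r : Fin ℓ) : Module.End ℂ (SUq q ℓ) :=
  (-((q : ℝ) : ℂ)) • contract (Matrix.entryLinearMap ℂ ℂ 0 1 ∘ₗ (pairF q r).toLinearMap)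

/-- `d_{M_i}`, where `M_ℓ = E_ℓ` and `M_i = E_i M_{i+1} - q⁻¹ M_{i+1} E_i`. -/
def dM (i : Fin ℓ) : Module.End ℂ (SUq q ℓ) :=
  if h : i.val + 1 < ℓ then
    dE i * dM ⟨i.val + 1, h⟩ - ((q : ℝ) : ℂ)⁻¹ • (dM ⟨i.val + 1, h⟩ * dE i)
  else dE i
termination_by ℓ - i.val

/-- `d_{M_i^*}`, where `M_ℓ^* = F_ℓ` and `M_i^* = M_{i+1}^* F_i - q⁻¹ F_i M_{i+1}^*`. -/
def dMstar (i : Fin ℓ) : Module.End ℂ (SUq q ℓ) :=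
  if h : i.val + 1 < ℓ then
    dMstar ⟨i.val + 1, h⟩ * dF i - ((q : ℝ) : ℂ)⁻¹ • (dF i * dMstar ⟨i.val + 1, h⟩)
  else dF i
termination_by ℓ - i.val

/-- `d_{N_i}`, where `N_i = K_i K_{i+1} ⋯ K_ℓ`. -/
def dN (i : Fin ℓ) : Module.End ℂ (SUq q ℓ) :=
  if h : i.val + 1 < ℓ then dK i * dN ⟨i.val + 1, h⟩ else dK i
termination_by ℓ - i.val

/-! ### Twisted antiholomorphic forms -/

variable (q ℓ)

/-- The space `O(SU_q(N)) ⊗ Λ(ℂ^ℓ)`: a form `∑_I ω_I ⊗ e_I` is the family of its components `ω_I`,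
with `I ⊆ {1, …, ℓ}`. -/
abbrev Forms : Type := Finset (Fin ℓ) → SUq q ℓ

/-- Operators on `Λ(ℂ^ℓ)`, as matrices with respect to the orthonormal basis `e_I`. -/
abbrev ExtOp (ℓ : ℕ) : Type := Matrix (Finset (Fin ℓ)) (Finset (Fin ℓ)) ℂ

variable {q ℓ}

/-- The operator `f ⊗ A` on `O(SU_q(N)) ⊗ Λ(ℂ^ℓ)`. -/
def tensorOp (f : Module.End ℂ (SUq q ℓ)) (A : ExtOp ℓ) : Module.End ℂ (Forms q ℓ) :=
  LinearMap.pi fun J => ∑ I, A J I • (f ∘ₗ LinearMap.proj I)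

lemma tensorOp_apply (f : Module.End ℂ (SUq q ℓ)) (A : ExtOp ℓ) (ω : Forms q ℓ)
    (J : Finset (Fin ℓ)) : tensorOp f A ω J = ∑ I, A J I • f (ω I) := by
  simp [tensorOp]

variable (q) in
/-- The `q`-deformed exterior multiplication `ε_j^q`: it sends `e_I` to
`(-q)^{-#(I ∩ {1, …, j})} e_{I ∪ {j}}` if `j ∉ I`, and to `0` if `j ∈ I`. -/
def extMul (j : Fin ℓ) : ExtOp ℓ := Matrix.of fun J I =>
  if j ∉ I ∧ J = insert j I then (-((q : ℝ) : ℂ)) ^ (-((I.filter (· ≤ j)).card : ℤ)) else 0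

variable (q) in
/-- `σ(K_r)`, with `s = r + 1`: it sends `e_I` to `q^{(δ_{r,I} - δ_{s,I})/2} e_I`. -/
def sigmaK (r s : Fin ℓ) : ExtOp ℓ := Matrix.of fun J I =>
  if J = I then sq q ^ ((if r ∈ I then 1 else 0) - (if s ∈ I then 1 else 0) : ℤ) else 0

/-- `σ(E_r)`, with `s = r + 1`: it sends `e_I` to `e_{(I ∖ {s}) ∪ {r}}` if `s ∈ I` and `r ∉ I`, and to
`0` otherwise. -/
def sigmaE (r s : Fin ℓ) : ExtOp ℓ := Matrix.of fun J I =>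
  if s ∈ I ∧ r ∉ I ∧ J = insert r (I.erase s) then 1 else 0

/-- `σ(F_r)`, with `s = r + 1`: it sends `e_I` to `e_{(I ∖ {r}) ∪ {s}}` if `r ∈ I` and `s ∉ I`, and to
`0` otherwise. -/
def sigmaF (r s : Fin ℓ) : ExtOp ℓ := Matrix.of fun J I =>
  if r ∈ I ∧ s ∉ I ∧ J = insert s (I.erase r) then 1 else 0

variable (q ℓ)

/-- The twisted antiholomorphic forms `Ω_M^k`: the forms `ω` of degree `k` such that
`d_{K_ℓ}(ω_I) = q^{(M - #I)/2 - δ_{ℓ,I}/2} ω_I` for all `I`, and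
`(d_{η₁} ⊗ σ(η₂)) ω = ε(η) ω` for all `η ∈ U_q(su(ℓ))`. As `η ↦ d_{η₁} ⊗ σ(η₂)` and `ε` are algebra
homomorphisms, the last condition is the same as the condition for the generators `K_r`, `E_r`, `F_r`
with `r < ℓ`, where `Δ(E_r) = E_r ⊗ K_r + K_r⁻¹ ⊗ E_r` and `Δ(F_r) = F_r ⊗ K_r + K_r⁻¹ ⊗ F_r`. -/
def Omega (M : ℤ) (k : ℕ) : Submodule ℂ (Forms q ℓ) where
  carrier := {ω | (∀ I, I.card ≠ k → ω I = 0) ∧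
    (∀ r : Fin ℓ, r.val + 1 = ℓ → ∀ I,
      dK r (ω I) = sq q ^ (M - (I.card : ℤ) - (if r ∈ I then 1 else 0)) • ω I) ∧
    (∀ r s : Fin ℓ, s.val = r.val + 1 →
      tensorOp (dK r) (sigmaK q r s) ω = ω ∧
      tensorOp (dE r) (sigmaK q r s) ω + tensorOp (dKinv r) (sigmaE r s) ω = 0 ∧
      tensorOp (dF r) (sigmaK q r s) ω + tensorOp (dKinv r) (sigmaF r s) ω = 0)}
  zero_mem' := by simp
  add_mem' := by
    rintro a b ⟨ha1, ha2, ha3⟩ ⟨hb1, hb2, hb3⟩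
    refine ⟨fun I hI => by simp [ha1 I hI, hb1 I hI],
      fun r hr I => by simp [ha2 r hr I, hb2 r hr I], fun r s hs => ?_⟩
    obtain ⟨a1, a2, a3⟩ := ha3 r s hs
    obtain ⟨b1, b2, b3⟩ := hb3 r s hs
    refine ⟨by rw [map_add, a1, b1], ?_, ?_⟩
    · rw [map_add, map_add, add_add_add_comm, a2, b2, add_zero]
    · rw [map_add, map_add, add_add_add_comm, a3, b3, add_zero]
  smul_mem' := by
    rintro c a ⟨ha1, ha2, ha3⟩
    refine ⟨fun I hI => by simp [ha1 I hI],
      fun r hr I => by rw [Pi.smul_apply, map_smul, ha2 r hr I, smul_comm], fun r s hs => ?_⟩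
    obtain ⟨a1, a2, a3⟩ := ha3 r s hs
    refine ⟨by rw [map_smul, a1], ?_, ?_⟩
    · rw [map_smul, map_smul, ← smul_add, a2, smul_zero]
    · rw [map_smul, map_smul, ← smul_add, a3, smul_zero]

variable {q ℓ}

/-- `∂̄ = ∑_i d_{N_i M_i^*} ⊗ ε_i^q`. -/
def dbar : Module.End ℂ (Forms q ℓ) := ∑ i : Fin ℓ, tensorOp (dN i * dMstar i) (extMul q i)

/-- `∂̄† = ∑_i d_{M_i N_i} ⊗ (ε_i^q)^*`. -/
def dbarDag : Module.End ℂ (Forms q ℓ) :=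
  ∑ i : Fin ℓ, tensorOp (dM i * dN i) (extMul q i).conjTranspose

/-- The Dirac operator `∂̄ + ∂̄†`, before taking its closure. -/
def dirac : Module.End ℂ (Forms q ℓ) := dbar + dbarDag

/-! ### Haar state and Hilbert spaces -/

open scoped ComplexOrder TensorProduct

/-- A state on `O(SU_q(N))` that is bi-invariant: `(1 ⊗ φ)Δ(x) = φ(x) 1 = (φ ⊗ 1)Δ(x)`. -/
structure IsHaarState (φ : SUq q ℓ →ₗ[ℂ] ℂ) : Prop where
  map_one : φ 1 = 1
  nonneg : ∀ x, 0 ≤ φ (star x * x)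
  right_inv : ∀ x, TensorProduct.rid ℂ (SUq q ℓ) (φ.lTensor (SUq q ℓ) (comul x)) = φ x • 1
  left_inv : ∀ x, TensorProduct.lid ℂ (SUq q ℓ) (φ.rTensor (SUq q ℓ) (comul x)) = φ x • 1

/-- There is at most one bi-invariant state. -/
lemma IsHaarState.unique {φ ψ : SUq q ℓ →ₗ[ℂ] ℂ} (hφ : IsHaarState φ) (hψ : IsHaarState ψ) :
    φ = ψ := by
  ext x
  have h : ∀ t : SUq q ℓ ⊗[ℂ] SUq q ℓ,
      ψ (TensorProduct.rid ℂ (SUq q ℓ) (φ.lTensor (SUq q ℓ) t)) =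
        φ (TensorProduct.lid ℂ (SUq q ℓ) (ψ.rTensor (SUq q ℓ) t)) := by
    intro t
    induction t using TensorProduct.induction_on with
    | zero => simp
    | tmul a b => simp [mul_comm]
    | add a b ha hb => simp only [map_add, ha, hb]
  have h1 := h (comul x)
  rw [hφ.right_inv, hψ.left_inv, map_smul, map_smul, hφ.map_one, hψ.map_one] at h1
  simpa using h1

variable (q ℓ)

open Classical in
/-- The Haar state `h`, restricted to the coordinate algebra: the unique bi-invariant state (it exists
by a theorem of Woronowicz). -/
def haar : SUq q ℓ →ₗ[ℂ] ℂ :=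
  if h : ∃ φ : SUq q ℓ →ₗ[ℂ] ℂ, IsHaarState φ then h.choose else 0

variable {q ℓ}

lemma haar_nonneg (x : SUq q ℓ) : 0 ≤ haar q ℓ (star x * x) := by
  unfold haar
  split_ifs with h
  · exact h.choose_spec.nonneg x
  · simp

lemma haar_conj (x y : SUq q ℓ) :
    starRingEnd ℂ (haar q ℓ (star y * x)) = haar q ℓ (star x * y) := by
  have h0 : ∀ z : SUq q ℓ, (haar q ℓ (star z * z)).im = 0 := fun z =>
    ((Complex.nonneg_iff.1 (haar_nonneg z)).2).symm
  have h1 := h0 (x + y)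
  have h2 := h0 (x + Complex.I • y)
  have hx := h0 x
  have hy := h0 y
  simp only [star_add, star_smul, add_mul, mul_add, map_add, smul_mul_assoc, mul_smul_comm,
    map_smul, Complex.add_im, smul_eq_mul, Complex.mul_im, Complex.I_re, Complex.I_im,
    Complex.mul_re, Complex.star_def, Complex.conj_I, Complex.neg_re, Complex.neg_im, hx, hy] at h1 h2
  apply Complex.ext
  · simp only [Complex.conj_re]; linarith
  · simp only [Complex.conj_im]; linarith

variable (q ℓ)

/-- The coordinate algebra, as a pre-Hilbert space with `⟨x, y⟩ = h(x^* y)`. -/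
def PreL2 : Type := SUq q ℓ

instance : AddCommGroup (PreL2 q ℓ) := inferInstanceAs (AddCommGroup (SUq q ℓ))
instance : Module ℂ (PreL2 q ℓ) := inferInstanceAs (Module ℂ (SUq q ℓ))

variable {q ℓ}

/-- The identity map. -/
def toPreL2 : SUq q ℓ ≃ₗ[ℂ] PreL2 q ℓ := LinearEquiv.refl ℂ _

variable (q ℓ)

/-- The inner product `⟨x, y⟩ = h(x^* y)`. -/
@[reducible] def preL2Core : PreInnerProductSpace.Core ℂ (PreL2 q ℓ) where
  inner a b := haar q ℓ (star (toPreL2.symm a) * toPreL2.symm b)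
  conj_inner_symm a b := haar_conj _ _
  re_inner_nonneg a := (Complex.nonneg_iff.1 (haar_nonneg _)).1
  add_left a b c := by rw [map_add, star_add, add_mul, map_add]
  smul_left a b r := by simp

instance : SeminormedAddCommGroup (PreL2 q ℓ) :=
  InnerProductSpace.Core.toSeminormedAddCommGroup (c := preL2Core q ℓ)
instance : InnerProductSpace ℂ (PreL2 q ℓ) := InnerProductSpace.ofCore (preL2Core q ℓ)

/-- The Hilbert space `L²(SU_q(N))` of the GNS construction for the Haar state: the completion of
`O(SU_q(N))`, which is dense in `C(SU_q(N))`. -/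
abbrev L2 : Type := UniformSpace.Completion (PreL2 q ℓ)

/-- The Hilbert space `L²(SU_q(N)) ⊗ Λ(ℂ^ℓ)`, with the orthonormal basis `e_I` of `Λ(ℂ^ℓ)`. -/
abbrev L2Forms : Type := PiLp 2 (fun _ : Finset (Fin ℓ) => L2 q ℓ)

variable {q ℓ}

/-- The canonical map `ι : O(SU_q(N)) → L²(SU_q(N))`. -/
def toL2 : SUq q ℓ →ₗ[ℂ] L2 q ℓ :=
  (UniformSpace.Completion.toComplL (𝕜 := ℂ) (E := PreL2 q ℓ)).toLinearMap ∘ₗ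
    toPreL2.toLinearMap

lemma inner_toL2 (x y : SUq q ℓ) : inner ℂ (toL2 x) (toL2 y) = haar q ℓ (star x * y) :=
  UniformSpace.Completion.inner_coe _ _

/-- The canonical map `ι ⊗ 1` from `O(SU_q(N)) ⊗ Λ(ℂ^ℓ)` to `L²(SU_q(N)) ⊗ Λ(ℂ^ℓ)`. -/
def toL2Forms : Forms q ℓ →ₗ[ℂ] L2Forms q ℓ :=
  (WithLp.linearEquiv 2 ℂ (Finset (Fin ℓ) → L2 q ℓ)).symm.toLinearMap ∘ₗ
    LinearMap.pi fun I => toL2 ∘ₗ LinearMap.proj I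

variable (q ℓ)

/-- The Hilbert space `L²(Ω_M^k, h)`: the closure of `Ω_M^k` in `L²(SU_q(N)) ⊗ Λ(ℂ^ℓ)`. -/
def L2Omega (M : ℤ) (k : ℕ) : Submodule ℂ (L2Forms q ℓ) :=
  ((Omega q ℓ M k).map toL2Forms).topologicalClosure

instance (M : ℤ) (k : ℕ) : CompleteSpace (L2Omega q ℓ M k) :=
  (Submodule.isClosed_topologicalClosure _).completeSpace_coe

variable {q ℓ}

lemma toL2Forms_mem {M : ℤ} {k : ℕ} {ω : Forms q ℓ} (h : ω ∈ Omega q ℓ M k) :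
    toL2Forms ω ∈ L2Omega q ℓ M k :=
  Submodule.le_topologicalClosure _ (Submodule.mem_map_of_mem h)

/-! ### Left multiplication -/

lemma norm_toPreL2_sq (x : SUq q ℓ) : ‖toPreL2 x‖ ^ 2 = (haar q ℓ (star x * x)).re := by
  rw [@norm_sq_eq_re_inner ℂ]; rfl

lemma norm_u_mul_le (i j : Fin (ℓ + 1)) (x : SUq q ℓ) :
    ‖toPreL2 (u i j * x)‖ ≤ ‖toPreL2 x‖ := by
  rw [← sq_le_sq₀ (norm_nonneg _) (norm_nonneg _), norm_toPreL2_sq, norm_toPreL2_sq]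
  have h : ∑ k, (haar q ℓ (star (u k j * x) * (u k j * x))).re = (haar q ℓ (star x * x)).re := by
    rw [← Complex.re_sum, ← map_sum]
    congr 2
    have h1 := sum_star_u_u (q := q) (ℓ := ℓ) j j
    rw [if_pos rfl] at h1
    calc ∑ k, star (u k j * x) * (u k j * x) = star x * (∑ k, star (u k j) * u k j) * x := by
          rw [Finset.mul_sum, Finset.sum_mul]
          simp only [star_mul, mul_assoc]
      _ = star x * x := by rw [h1, mul_one]
  rw [← h]
  exact Finset.single_le_sum (f := fun k => (haar q ℓ (star (u k j * x) * (u k j * x))).re)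
    (fun k _ => (Complex.nonneg_iff.1 (haar_nonneg _)).1) (Finset.mem_univ i)

lemma exists_norm_mul_le (a : SUq q ℓ) :
    ∃ C : ℝ, ∀ x : SUq q ℓ, ‖toPreL2 (a * x)‖ ≤ C * ‖toPreL2 x‖ := by
  suffices ∃ C : ℝ, 0 ≤ C ∧ ∀ x : SUq q ℓ, ‖toPreL2 (a * x)‖ ≤ C * ‖toPreL2 x‖ from
    this.imp fun _ h => h.2
  induction a using SUq.induction with
  | h1 c =>
    refine ⟨‖c‖, norm_nonneg _, fun x => ?_⟩
    rw [← Algebra.smul_def, map_smul, norm_smul]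
  | h2 i j => exact ⟨1, zero_le_one, fun x => by rw [one_mul]; exact norm_u_mul_le i j x⟩
  | h3 a b ha hb =>
    obtain ⟨C, hC, h⟩ := ha
    obtain ⟨D, hD, h'⟩ := hb
    refine ⟨C + D, add_nonneg hC hD, fun x => ?_⟩
    rw [add_mul, map_add, add_mul]
    exact (norm_add_le _ _).trans (add_le_add (h x) (h' x))
  | h4 a b ha hb =>
    obtain ⟨C, hC, h⟩ := ha
    obtain ⟨D, hD, h'⟩ := hb
    refine ⟨C * D, mul_nonneg hC hD, fun x => ?_⟩
    rw [mul_assoc, mul_assoc]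
    exact (h _).trans (mul_le_mul_of_nonneg_left (h' x) hC)

/-- Left multiplication by `a` on the pre-Hilbert space `O(SU_q(N))`. -/
def leftMulPre (a : SUq q ℓ) : PreL2 q ℓ →L[ℂ] PreL2 q ℓ :=
  (toPreL2.toLinearMap ∘ₗ LinearMap.mulLeft ℂ a ∘ₗ toPreL2.symm.toLinearMap).mkContinuous
    (exists_norm_mul_le a).choose (fun x => (exists_norm_mul_le a).choose_spec (toPreL2.symm x))

/-- The operator on `L²(SU_q(N))` by which `a` acts in the GNS representation. -/
def leftMul (a : SUq q ℓ) : L2 q ℓ →L[ℂ] L2 q ℓ := (leftMulPre a).completion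

lemma leftMul_toL2 (a x : SUq q ℓ) : leftMul a (toL2 x) = toL2 (a * x) :=
  ContinuousLinearMap.completion_apply_coe (leftMulPre a) (toPreL2 x)

/-- The operator `a ⊗ 1` on `L²(SU_q(N)) ⊗ Λ(ℂ^ℓ)`. -/
def leftMulForms (a : SUq q ℓ) : L2Forms q ℓ →L[ℂ] L2Forms q ℓ :=
  (PiLp.continuousLinearEquiv 2 ℂ (fun _ : Finset (Fin ℓ) => L2 q ℓ)).symm.toContinuousLinearMap ∘L
    ContinuousLinearMap.pi (fun I => leftMul a ∘L ContinuousLinearMap.proj I) ∘L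
    (PiLp.continuousLinearEquiv 2 ℂ (fun _ : Finset (Fin ℓ) => L2 q ℓ)).toContinuousLinearMap

/-! ### Quantum projective space and the gradient -/

/-- `z_i = u_{Ni}`. -/
def z (i : Fin (ℓ + 1)) : SUq q ℓ := u (Fin.last ℓ) i

variable (q ℓ)

/-- The coordinate algebra `O(ℂP_q^ℓ)`: the unital `*`-subalgebra generated by the `z_i z_j^*`. -/
def CPq : StarSubalgebra ℂ (SUq q ℓ) :=
  StarAlgebra.adjoin ℂ {x | ∃ i j : Fin (ℓ + 1), x = z i * star (z j)}

/-- `y_ℓ = z_1 z_1^* + ⋯ + z_ℓ z_ℓ^*`. -/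
def yl : CPq q ℓ :=
  ⟨∑ i : Fin ℓ, z i.castSucc * star (z i.castSucc),
    sum_mem fun i _ => StarAlgebra.subset_adjoin ℂ _ ⟨i.castSucc, i.castSucc, rfl⟩⟩

variable {q ℓ}

/-- `T` is the gradient `∇(x)`: the bounded operator from `L²(Ω_M^0, h)` to `L²(Ω_M^1, h)` which on the
dense subspace `Ω_M^0` is minus the commutator of the Dirac operator with `x`. -/
def IsGradient (M : ℤ) (x : CPq q ℓ) (T : L2Omega q ℓ M 0 →L[ℂ] L2Omega q ℓ M 1) :
    Prop :=
  ∀ (ω : Forms q ℓ) (hω : ω ∈ Omega q ℓ M 0),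
    (T ⟨toL2Forms ω, toL2Forms_mem hω⟩ : L2Forms q ℓ) =
      -toL2Forms (dirac (fun I => (x : SUq q ℓ) * ω I) - fun I => (x : SUq q ℓ) * dirac ω I)

lemma leftMulForms_toL2Forms (a : SUq q ℓ) (ω : Forms q ℓ) :
    leftMulForms a (toL2Forms ω) = toL2Forms (fun I => a * ω I) := by
  ext I
  exact leftMul_toL2 a (ω I)

/-- There is at most one gradient. -/
lemma IsGradient.unique {M : ℤ} {x : CPq q ℓ} {T T' : L2Omega q ℓ M 0 →L[ℂ] L2Omega q ℓ M 1}
    (hT : IsGradient M x T) (hT' : IsGradient M x T') : T = T' := by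
  have h : IsClosed {v | T v = T' v} := isClosed_eq T.continuous T'.continuous
  ext v : 1
  refine h.closure_eq.subset (closure_subtype.2 (closure_mono ?_ v.2))
  rintro _ ⟨ω, hω, rfl⟩
  exact ⟨⟨toL2Forms ω, toL2Forms_mem hω⟩, Subtype.ext ((hT ω hω).trans (hT' ω hω).symm), rfl⟩

open Classical in
/-- The gradient `∇(x)` of `x ∈ O(ℂP_q^ℓ)`: the unique bounded operator with the property
`IsGradient`. -/
def nabla (M : ℤ) (x : CPq q ℓ) :
    L2Omega q ℓ M 0 →L[ℂ] L2Omega q ℓ M 1 :=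
  if h : ∃ T, IsGradient M x T then h.choose else 0

end CoordinateAlgebra

end QuantumSU

end

open QuantumSU

/-! On forms of degree zero the commutator of the Dirac operator with `y = yl` contains no
derivative of the section. Indices run from 1 to `N = ℓ + 1` in this explanation, whereas `Fin`
counts from 0. A section `f` in `Ω_M^0` is killed by `E_r` and `F_r` and fixed by `K_r` for `r < ℓ`.
The same holds for `y = 1 - z_N z_N^*`, which is also fixed by `K_ℓ`. The twisted Leibniz rule makes
`F_ℓ y` a multiple of `z_N u_{ℓN}^*`, and the q-commutators that define `M_i^*` carry this element
to `z_N u_{iN}^*`. The result, `neg_commutator_dirac_yl`, is that the gradient sends `f` to `∑_i x_i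
f ⊗ e_i` with `x_i = q^{-3/2} (-q)^{i-ℓ} z_N u_{iN}^*`. It therefore extends to a bounded operator
built from left multiplications, and `∇^*∇` has to be left multiplication by `∑_i x_i^* x_i`.

This sum is computed in `sum_star_mul_self_z_last` from the exchange relations between the last
column of `u` and its adjoint (`star_u_mul_u_last_exchange`). The factor `u_{iN}^*` commutes with
`z_N^* z_N`, the weighted sum of the `u_{iN} u_{iN}^*` telescopes to a power of `q`, and `z_N^* z_N
= 1 - q² y`.

The analytic part is a density argument. `gradForm_mem_Omega` places the explicit form in `Ω_M^1`,
so that the operator has the right codomain. `inner_gradForm` then compares inner products on smooth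
sections, where only `⟨x, y⟩ = h(x^* y)` is needed. -/

noncomputable section

namespace QuantumSU
open Finset

/-! ### Exchange relations between a quantum matrix and its transposed inverse -/

section Minors
variable {B : Type*} [Ring B] [Algebra ℂ B] {n : ℕ}

/-- One entry of the matrix equation `R U₁ U₂ = U₁ U₂ R`. It is uniform in the four indices, which
can thus be summed over without separating the cases of the quadratic relations. -/
lemma IsQuantumMatrix.exchange {q : ℂ} (hq : q ≠ 0) {U : Fin n → Fin n → B}
    (hU : IsQuantumMatrix q U) (i j k l : Fin n) :
    (if i = j then q else 1) • (U j k * U i l) + (if i < j then q - q⁻¹ else 0) • (U i k * U j l)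
      = (if k = l then q else 1) • (U i l * U j k) +
        (if k < l then q - q⁻¹ else 0) • (U i k * U j l) := by
  have := congrFun (congrFun ((isQuantumMatrix_iff hq U).1 hU) (i, j)) (k, l)
  rwa [rMatB_mul_apply, mul_rMatB_apply] at this

/-- The relations between the last column of a quantum matrix and that of its transposed inverse. -/
lemma IsQuantumMatrix.exchange_inv_last {q : ℂ} (hq : q ≠ 0) {U V : Fin (n + 1) → Fin (n + 1) → B}
    (hU : IsQuantumMatrix q U) (h1 : ∀ i j, ∑ k, U i k * V j k = if i = j then 1 else 0)
    (h2 : ∀ i j, ∑ k, V k i * U k j = if i = j then 1 else 0) (c j : Fin (n + 1)) :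
    (if c = j then q else 1) • (V c (Fin.last n) * U j (Fin.last n)) +
      (if j = c then q - q⁻¹ else 0) • ∑ i with i < j, V i (Fin.last n) * U i (Fin.last n)
      = q • (U j (Fin.last n) * V c (Fin.last n)) := by
  set N := Fin.last n
  -- The exchange relation with column indices `N` and `l`, multiplied on the right by `V c l` and
  -- summed over `l`. The condition `N < l` never holds, so one of its four terms is absent.
  have s1 : ∀ i, (if i = j then q else 1) • (if i = c then U j N else 0) +
      (if i < j then q - q⁻¹ else 0) • (if j = c then U i N else 0)
      = ∑ l, (if N = l then q else 1) • (U i l * U j N * V c l) := by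
    intro i
    have e1 : (if i = c then U j N else 0) = ∑ l, U j N * (U i l * V c l) := by
      rw [← Finset.mul_sum, h1]; simp
    have e2 : (if j = c then U i N else 0) = ∑ l, U i N * (U j l * V c l) := by
      rw [← Finset.mul_sum, h1]; simp
    rw [e1, e2, Finset.smul_sum, Finset.smul_sum, ← Finset.sum_add_distrib]
    refine Finset.sum_congr rfl fun l _ => ?_
    have := congrArg (· * V c l) (hU.exchange hq i j N l)
    have hl : ¬ N < l := (Fin.le_last l).not_gt
    simp only [if_neg hl, zero_smul, add_zero, add_mul, smul_mul_assoc, mul_assoc] at this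
    simpa only [mul_assoc] using this
  -- Multiplication on the left by `V i N` and summation over `i`. The other inverse relation then
  -- leaves only `l = N` on the right-hand side, where the coefficient is `q`.
  have s2 := Finset.sum_congr (rfl : (univ : Finset (Fin (n + 1))) = univ)
    fun i (_ : i ∈ univ) => congrArg (V i N * ·) (s1 i)
  simp only [mul_add, Finset.sum_add_distrib, Finset.mul_sum, mul_smul_comm] at s2
  rw [Finset.sum_comm] at s2
  have s3 : ∀ l, ∑ i, (if N = l then q else 1) • (V i N * (U i l * U j N * V c l))
      = if N = l then q • (U j N * V c N) else 0 := by
    intro l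
    rw [← Finset.smul_sum]
    have : ∑ i, V i N * (U i l * U j N * V c l) = (∑ i, V i N * U i l) * (U j N * V c l) := by
      rw [Finset.sum_mul]; simp only [mul_assoc]
    rw [this, h2]
    by_cases h : N = l
    · subst h; simp
    · simp [h]
  simp only [s3, Finset.sum_ite_eq, Finset.mem_univ, if_true] at s2
  rw [← s2]
  congr 1
  · simp
  · rw [Finset.smul_sum, Finset.sum_filter]
    refine Finset.sum_congr rfl fun i _ => ?_
    by_cases h : j = c <;> by_cases h' : i < j <;> simp [h, h']

end Minors

/-! ### The last column of the fundamental unitary and the identity for `yl` -/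

section CoordinateAlgebra
variable {q : Set.Ioo (0 : ℝ) 1} {ℓ : ℕ}

/-- Unitarity says that the entrywise adjoint of `u` is its transposed inverse. -/
lemma star_u_mul_u_last_exchange (c j : Fin (ℓ + 1)) :
    (if c = j then ((q : ℝ) : ℂ) else 1) • (star (u (q := q) c (Fin.last ℓ)) * u j (Fin.last ℓ)) +
      (if j = c then ((q : ℝ) : ℂ) - ((q : ℝ) : ℂ)⁻¹ else 0) •
        ∑ i with i < j, star (u (q := q) i (Fin.last ℓ)) * u i (Fin.last ℓ)
      = ((q : ℝ) : ℂ) • (u j (Fin.last ℓ) * star (u c (Fin.last ℓ))) :=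
  isQuantumMatrix_u.exchange_inv_last (V := fun i j => star (u i j)) (qc_ne_zero q)
    sum_u_star_u sum_star_u_u c j

/-- The off-diagonal case of the exchange relation, where the correction sum is absent. -/
lemma star_u_mul_z_last (i : Fin ℓ) :
    star (u (q := q) i.castSucc (Fin.last ℓ)) * z (Fin.last ℓ)
      = ((q : ℝ) : ℂ) • (z (Fin.last ℓ) * star (u i.castSucc (Fin.last ℓ))) := by
  have := star_u_mul_u_last_exchange (q := q) i.castSucc (Fin.last ℓ)
  have h : i.castSucc ≠ Fin.last ℓ := Fin.castSucc_ne_last i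
  rw [if_neg h, if_neg h.symm] at this
  simpa [z] using this

lemma sum_z_star_z : ∑ i : Fin ℓ, z (q := q) i.castSucc * star (z i.castSucc)
    = 1 - z (Fin.last ℓ) * star (z (Fin.last ℓ)) := by
  have := sum_u_star_u (q := q) (Fin.last ℓ) (Fin.last ℓ)
  rw [Fin.sum_univ_castSucc, if_pos rfl] at this
  rw [← this]; simp [z]

/-- The form `z_N^* z_N = 1 - q² + q² z_N z_N^*` of the exchange relation. -/
lemma star_z_last_mul_z_last : star (z (q := q) (Fin.last ℓ)) * z (Fin.last ℓ)
    = 1 - ((q : ℝ) : ℂ) ^ 2 • (1 - z (Fin.last ℓ) * star (z (Fin.last ℓ))) := by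
  have h := star_u_mul_u_last_exchange (q := q) (Fin.last ℓ) (Fin.last ℓ)
  have h1 := sum_star_u_u (q := q) (Fin.last ℓ) (Fin.last ℓ)
  rw [Fin.sum_univ_castSucc, if_pos rfl] at h1
  -- The correction sum in the diagonal relation runs over all rows but the last. Unitarity of the
  -- column expresses it through `z_N`, so the relation closes up.
  have h2 : ∑ i with i < Fin.last ℓ, star (u (q := q) i (Fin.last ℓ)) * u i (Fin.last ℓ)
      = 1 - star (z (Fin.last ℓ)) * z (Fin.last ℓ) := by
    rw [Finset.sum_filter, Fin.sum_univ_castSucc, eq_sub_iff_add_eq, ← h1]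
    simp [Fin.castSucc_lt_last, z]
  rw [if_pos rfl, if_pos rfl, h2] at h
  change _ • (star (z (Fin.last ℓ)) * z (Fin.last ℓ)) + _
    = _ • (z (Fin.last ℓ) * star (z (Fin.last ℓ))) at h
  have hq := qc_ne_zero q
  have h3 := congrArg (((q : ℝ) : ℂ) • ·) h
  simp only [smul_add, smul_smul, mul_inv_cancel₀ hq, smul_sub, sub_smul, one_smul] at h3
  rw [← sub_eq_zero] at h3 ⊢
  rw [← h3]
  module

/-- With `a_i = u_{iN}^* u_{iN}`, the diagonal exchange relation reads `u_{jN} u_{jN}^* = a_j + (1 -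
q^{-2}) ∑_{i<j} a_i`. The weights `q^{2j}` make the sum over `j` telescope, and `∑_i a_i = 1` by
unitarity. -/
lemma sum_u_star_u_last_weighted :
    ∑ i : Fin (ℓ + 1), ((q : ℝ) : ℂ) ^ (2 * (i : ℕ)) •
      (u (q := q) i (Fin.last ℓ) * star (u i (Fin.last ℓ)))
      = ((q : ℝ) : ℂ) ^ (2 * ℓ) • (1 : SUq q ℓ) := by
  have hq := qc_ne_zero q
  set a : Fin (ℓ + 1) → SUq q ℓ := fun i => star (u i (Fin.last ℓ)) * u i (Fin.last ℓ) with ha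
  -- Extension by zero to `ℕ`, so that the telescoping can be an induction on the length of the sum.
  set b : ℕ → SUq q ℓ := fun i => if h : i < ℓ + 1 then a ⟨i, h⟩ else 0 with hb
  have hab : ∀ i : Fin (ℓ + 1), b i = a i := fun i => dif_pos i.2
  have hsum : ∀ j : Fin (ℓ + 1), ∑ i with i < j, a i = ∑ t ∈ range (j : ℕ), b t := by
    intro j
    refine Finset.sum_bij (fun i _ => (i : ℕ)) (fun i hi => ?_) (fun i _ j _ h => Fin.ext h)
      (fun t ht => ?_) (fun i _ => (hab i).symm)
    · simpa using hi
    · exact ⟨⟨t, (Finset.mem_range.1 ht).trans j.2⟩, by simpa only [Finset.mem_filter, Finset.mem_univ, true_and, Fin.lt_def, Finset.mem_range] using ht, rfl⟩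
  have hterm : ∀ j : Fin (ℓ + 1), ((q : ℝ) : ℂ) ^ (2 * (j : ℕ)) •
      (u (q := q) j (Fin.last ℓ) * star (u j (Fin.last ℓ)))
      = ((q : ℝ) : ℂ) ^ (2 * (j : ℕ)) • (b j + (1 - (((q : ℝ) : ℂ) ^ 2)⁻¹) •
        ∑ t ∈ range (j : ℕ), b t) := by
    intro j
    have h := star_u_mul_u_last_exchange (q := q) j j
    rw [if_pos rfl, if_pos rfl] at h
    congr 1
    have h3 := congrArg (((q : ℝ) : ℂ)⁻¹ • ·) h
    simp only [smul_add, smul_smul, inv_mul_cancel₀ hq, one_smul] at h3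
    rw [← h3, ← hsum, hab]
    congr 2
    field_simp
  simp only [hterm]
  rw [Fin.sum_univ_eq_sum_range (fun j => ((q : ℝ) : ℂ) ^ (2 * j) •
    (b j + (1 - (((q : ℝ) : ℂ) ^ 2)⁻¹) • ∑ t ∈ range j, b t))]
  -- With `S_j` the partial sums of `b`, the summand times `q²` is `q^{2(j+1)} S_{j+1} - q^{2j}
  -- S_j`.
  have htel : ∀ m : ℕ, ((q : ℝ) : ℂ) ^ 2 • ∑ j ∈ range m, ((q : ℝ) : ℂ) ^ (2 * j) •
      (b j + (1 - (((q : ℝ) : ℂ) ^ 2)⁻¹) • ∑ t ∈ range j, b t)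
      = ((q : ℝ) : ℂ) ^ (2 * m) • ∑ t ∈ range m, b t := by
    intro m
    induction m with
    | zero => simp
    | succ m ih =>
      rw [Finset.sum_range_succ, smul_add, ih, Finset.sum_range_succ]
      match_scalars
      · field_simp; ring
      · field_simp; ring
  have h1 := htel (ℓ + 1)
  have h2 : ∑ t ∈ range (ℓ + 1), b t = 1 := by
    rw [← Fin.sum_univ_eq_sum_range b]
    simp only [hab, ha]
    simpa using sum_star_u_u (q := q) (Fin.last ℓ) (Fin.last ℓ)
  rw [h2] at h1
  have h3 := congrArg ((((q : ℝ) : ℂ) ^ 2)⁻¹ • ·) h1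
  simp only [smul_smul, inv_mul_cancel₀ (pow_ne_zero 2 hq), one_smul] at h3
  rw [h3]
  congr 1
  field_simp
  ring

/-- The algebraic identity behind `∇(y_ℓ)^* ∇(y_ℓ) = q⁻¹ y_ℓ (1 - q² y_ℓ)`. -/
lemma sum_star_mul_self_z_last :
    ∑ i : Fin ℓ, ((q : ℝ) : ℂ) ^ (2 * (i : ℕ)) •
      (star (z (Fin.last ℓ) * star (u (q := q) i.castSucc (Fin.last ℓ))) *
        (z (Fin.last ℓ) * star (u i.castSucc (Fin.last ℓ))))
      = ((q : ℝ) : ℂ) ^ (2 * ℓ) • ((yl q ℓ : SUq q ℓ) *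
        (1 - ((q : ℝ) : ℂ) ^ 2 • (yl q ℓ : SUq q ℓ))) := by
  have hq := qc_ne_zero q
  have hy : (yl q ℓ : SUq q ℓ) = 1 - z (Fin.last ℓ) * star (z (Fin.last ℓ)) := sum_z_star_z
  set w := z (q := q) (Fin.last ℓ)
  -- The adjoint of `v = u_{iN}` moves to the left through `w^* w`: passing `w` costs `q⁻¹` and
  -- passing `w^*` costs `q`, so the factors cancel.
  have h1 : ∀ i : Fin ℓ, star (w * star (u (q := q) i.castSucc (Fin.last ℓ))) *
      (w * star (u i.castSucc (Fin.last ℓ)))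
      = u i.castSucc (Fin.last ℓ) * star (u i.castSucc (Fin.last ℓ)) * (star w * w) := by
    intro i
    set v := u (q := q) i.castSucc (Fin.last ℓ)
    have e1 : star v * w = ((q : ℝ) : ℂ) • (w * star v) := star_u_mul_z_last i
    have e2 : star w * v = ((q : ℝ) : ℂ) • (v * star w) := by
      have := congrArg star e1
      simpa using this
    have e3 : w * star v = ((q : ℝ) : ℂ)⁻¹ • (star v * w) := by
      rw [e1, smul_smul, inv_mul_cancel₀ hq, one_smul]
    have e4 : star w * star v = ((q : ℝ) : ℂ) • (star v * star w) := by
      have : v * w = ((q : ℝ) : ℂ) • (w * v) :=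
        isQuantumMatrix_u.col _ _ _ (Fin.castSucc_lt_last i)
      have := congrArg star this
      simpa using this
    rw [star_mul, star_star, e3, mul_smul_comm, mul_assoc, ← mul_assoc (star w), e4,
      smul_mul_assoc, mul_smul_comm, smul_smul, inv_mul_cancel₀ hq, one_smul]
    simp only [mul_assoc]
  -- Without its last term `q^{2ℓ} z_N z_N^*`, the weighted sum equals `q^{2ℓ} (1 - z_N z_N^*) =
  -- q^{2ℓ} y`.
  have h2 := sum_u_star_u_last_weighted (q := q) (ℓ := ℓ)
  rw [Fin.sum_univ_castSucc] at h2
  simp only [Fin.val_castSucc, Fin.val_last] at h2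
  simp only [h1]
  simp only [← smul_mul_assoc (_ ^ _) (_ * _) (star w * w)]
  rw [← Finset.sum_mul, eq_sub_of_add_eq h2, star_z_last_mul_z_last, hy, ← smul_sub, smul_mul_assoc]
  rfl

/-! ### Twisted Leibniz rules and the action on the generators and their adjoints -/

open scoped TensorProduct in
lemma contract_u (f : SUq q ℓ →ₗ[ℂ] ℂ) (i j : Fin (ℓ + 1)) :
    contract f (u i j) = ∑ k, f (u i k) • u k j := by
  simp [contract, comul_u]

open scoped TensorProduct in
lemma contract_one (f : SUq q ℓ →ₗ[ℂ] ℂ) : contract f 1 = f 1 • 1 := by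
  simp [contract, Algebra.TensorProduct.one_def]

open scoped TensorProduct in
/-- The contraction with a matrix coefficient of a product is a sum of products. -/
lemma contract_entry_mul (ρ : SUq q ℓ →ₐ[ℂ] Matrix (Fin 2) (Fin 2) ℂ) (i j : Fin 2)
    (x y : SUq q ℓ) :
    contract (Matrix.entryLinearMap ℂ ℂ i j ∘ₗ ρ.toLinearMap) (x * y)
      = ∑ k, contract (Matrix.entryLinearMap ℂ ℂ i k ∘ₗ ρ.toLinearMap) x *
          contract (Matrix.entryLinearMap ℂ ℂ k j ∘ₗ ρ.toLinearMap) y := by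
  have h : ∀ s t : SUq q ℓ ⊗[ℂ] SUq q ℓ,
      TensorProduct.lid ℂ (SUq q ℓ)
        ((Matrix.entryLinearMap ℂ ℂ i j ∘ₗ ρ.toLinearMap).rTensor (SUq q ℓ) (s * t))
      = ∑ k, TensorProduct.lid ℂ (SUq q ℓ)
          ((Matrix.entryLinearMap ℂ ℂ i k ∘ₗ ρ.toLinearMap).rTensor (SUq q ℓ) s) *
        TensorProduct.lid ℂ (SUq q ℓ)
          ((Matrix.entryLinearMap ℂ ℂ k j ∘ₗ ρ.toLinearMap).rTensor (SUq q ℓ) t) := by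
    intro s t
    induction s using TensorProduct.induction_on with
    | zero => simp
    | add a b ha hb =>
      rw [add_mul, map_add, map_add, ha, hb, ← Finset.sum_add_distrib]
      simp only [map_add, add_mul]
    | tmul a b =>
      induction t using TensorProduct.induction_on with
      | zero => simp
      | add c d hc hd =>
        rw [mul_add, map_add, map_add, hc, hd, ← Finset.sum_add_distrib]
        simp only [map_add, mul_add]
      | tmul c d =>
        rw [Algebra.TensorProduct.tmul_mul_tmul]
        simp only [LinearMap.rTensor_tmul, TensorProduct.lid_tmul, LinearMap.comp_apply,
          AlgHom.toLinearMap_apply, Matrix.entryLinearMap_apply, map_mul, Matrix.mul_apply,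
          smul_mul_assoc, mul_smul_comm, smul_smul, Finset.sum_smul]
        simp only [mul_comm]
  have := h (comul x) (comul y)
  rw [← map_mul] at this
  exact this

/-- Two upper triangular representations of size two with the same diagonal on the generators have
the same diagonal. -/
lemma entries_eq_of_skewMat {w : Fin (ℓ + 1) → ℂ} {a b c d : Fin (ℓ + 1)}
    {ρ ρ' : SUq q ℓ →ₐ[ℂ] Matrix (Fin 2) (Fin 2) ℂ} (h : ∀ i j, ρ (u i j) = skewMat w a b i j)
    (h' : ∀ i j, ρ' (u i j) = skewMat w c d i j) (x : SUq q ℓ) :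
    ρ x 1 0 = 0 ∧ ρ' x 1 0 = 0 ∧ ρ x 0 0 = ρ' x 0 0 ∧ ρ x 1 1 = ρ' x 1 1 := by
  induction x using SUq.induction with
  | h1 c => simp [Algebra.algebraMap_eq_smul_one]
  | h2 i j => simp [h, h', skewMat]
  | h3 x y hx hy => simp [hx, hy]
  | h4 x y hx hy => simp [Matrix.mul_apply, Fin.sum_univ_two, hx, hy]

lemma pairE_u (r : Fin ℓ) (i j : Fin (ℓ + 1)) :
    pairE q r (u i j) = skewMat (kWeight q r) r.succ r.castSucc i j := SUq.lift_u _ _ _ i j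

lemma pairF_u (r : Fin ℓ) (i j : Fin (ℓ + 1)) :
    pairF q r (u i j) = skewMat (kWeight q r) r.castSucc r.succ i j := SUq.lift_u _ _ _ i j

/-- The representation is upper triangular. This reduces the product formula for its diagonal
entries to a single term, so that `dK` and `dKinv` are multiplicative. -/
lemma contract_pairE_lower (r : Fin ℓ) :
    contract (Matrix.entryLinearMap ℂ ℂ 1 0 ∘ₗ (pairE q r).toLinearMap) = 0 := by
  have : Matrix.entryLinearMap ℂ ℂ 1 0 ∘ₗ (pairE q r).toLinearMap = 0 := by
    ext x; exact (entries_eq_of_skewMat (pairE_u r) (pairF_u r) x).1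
  rw [this]; simp [contract]

/-- `dK` is defined through `pairE`, while the Leibniz rule for `dF` produces the diagonal entries
of `pairF`. -/
lemma dK_eq_contract_pairF (r : Fin ℓ) :
    dK (q := q) r = contract (Matrix.entryLinearMap ℂ ℂ 0 0 ∘ₗ (pairF q r).toLinearMap) := by
  rw [dK]; congr 1; ext x
  exact (entries_eq_of_skewMat (pairE_u r) (pairF_u r) x).2.2.1

lemma dKinv_eq_contract_pairF (r : Fin ℓ) :
    dKinv (q := q) r = contract (Matrix.entryLinearMap ℂ ℂ 1 1 ∘ₗ (pairF q r).toLinearMap) := by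
  rw [dKinv]; congr 1; ext x
  exact (entries_eq_of_skewMat (pairE_u r) (pairF_u r) x).2.2.2

lemma dK_mul (r : Fin ℓ) (x y : SUq q ℓ) : dK r (x * y) = dK r x * dK r y := by
  rw [dK, contract_entry_mul, Fin.sum_univ_two, contract_pairE_lower]; simp

lemma dKinv_mul (r : Fin ℓ) (x y : SUq q ℓ) : dKinv r (x * y) = dKinv r x * dKinv r y := by
  rw [dKinv, contract_entry_mul, Fin.sum_univ_two, contract_pairE_lower]; simp

/-- The `(0, 1)` entry of the product formula. Since pairing with `K_r` gives `d_{K_r⁻¹}`, the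
factors `K_r` and `K_r⁻¹` change places compared with `Δ(E_r)`. -/
lemma dE_mul (r : Fin ℓ) (x y : SUq q ℓ) :
    dE r (x * y) = dK r x * dE r y + dE r x * dKinv r y := by
  rw [dE, LinearMap.smul_apply, contract_entry_mul, Fin.sum_univ_two, dK, dKinv]
  simp only [smul_add, LinearMap.smul_apply, mul_smul_comm, smul_mul_assoc]

lemma dF_mul (r : Fin ℓ) (x y : SUq q ℓ) :
    dF r (x * y) = dK r x * dF r y + dF r x * dKinv r y := by
  rw [dF, LinearMap.smul_apply, contract_entry_mul, Fin.sum_univ_two, dK_eq_contract_pairF,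
    dKinv_eq_contract_pairF]
  simp only [smul_add, LinearMap.smul_apply, mul_smul_comm, smul_mul_assoc]

lemma dK_one (r : Fin ℓ) : dK r (1 : SUq q ℓ) = 1 := by rw [dK, contract_one]; simp
lemma dKinv_one (r : Fin ℓ) : dKinv r (1 : SUq q ℓ) = 1 := by rw [dKinv, contract_one]; simp
lemma dE_one (r : Fin ℓ) : dE r (1 : SUq q ℓ) = 0 := by
  rw [dE, LinearMap.smul_apply, contract_one]; simp
lemma dF_one (r : Fin ℓ) : dF r (1 : SUq q ℓ) = 0 := by
  rw [dF, LinearMap.smul_apply, contract_one]; simp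

lemma dK_u (r : Fin ℓ) (i j : Fin (ℓ + 1)) : dK r (u (q := q) i j) = (kWeight q r i)⁻¹ • u i j := by
  rw [dK, contract_u]; simp [pairE_u, skewMat, ite_smul]

lemma dKinv_u (r : Fin ℓ) (i j : Fin (ℓ + 1)) : dKinv r (u (q := q) i j) = kWeight q r i • u i j := by
  rw [dKinv, contract_u]; simp [pairE_u, skewMat, ite_smul]

lemma dE_u (r : Fin ℓ) (i j : Fin (ℓ + 1)) : dE r (u (q := q) i j)
    = if i = r.succ then (-((q : ℝ) : ℂ)⁻¹) • u r.castSucc j else 0 := by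
  rw [dE, LinearMap.smul_apply, contract_u]
  by_cases h : i = r.succ <;> simp [pairE_u, skewMat, ite_smul, h]

lemma dF_u (r : Fin ℓ) (i j : Fin (ℓ + 1)) : dF r (u (q := q) i j)
    = if i = r.castSucc then (-((q : ℝ) : ℂ)) • u r.succ j else 0 := by
  rw [dF, LinearMap.smul_apply, contract_u]
  by_cases h : i = r.castSucc <;> simp [pairF_u, skewMat, ite_smul, h]

lemma kWeight_ne_zero (r : Fin ℓ) (i : Fin (ℓ + 1)) : kWeight q r i ≠ 0 := by
  unfold kWeight; split_ifs <;> simp [sq_ne_zero]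

lemma kWeight_succ (r : Fin ℓ) : kWeight q r r.succ = sq q := if_pos rfl

lemma kWeight_castSucc (r : Fin ℓ) : kWeight q r r.castSucc = (sq q)⁻¹ := by
  rw [kWeight, if_neg Fin.castSucc_lt_succ.ne, if_pos rfl]

lemma dKinv_dK (r : Fin ℓ) (x : SUq q ℓ) : dKinv r (dK r x) = x := by
  induction x using SUq.induction with
  | h1 c => rw [Algebra.algebraMap_eq_smul_one, map_smul, map_smul, dK_one, dKinv_one]
  | h2 i j => rw [dK_u, map_smul, dKinv_u, smul_smul, inv_mul_cancel₀ (kWeight_ne_zero r i), one_smul]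
  | h3 x y hx hy => rw [map_add, map_add, hx, hy]
  | h4 x y hx hy => rw [dK_mul, dKinv_mul, hx, hy]

/-- An element is determined by multiplication with a row of the fundamental unitary. -/
lemma eq_of_sum_u_mul {x : Fin (ℓ + 1) → SUq q ℓ} {y : Fin (ℓ + 1) → SUq q ℓ}
    (h : ∀ i, ∑ k, u i k * x k = y i) (k : Fin (ℓ + 1)) : x k = ∑ i, star (u i k) * y i := by
  simp only [← h, Finset.mul_sum, ← mul_assoc]
  rw [Finset.sum_comm]
  simp only [← Finset.sum_mul, sum_star_u_u]
  simp

/-- No cofactors are needed for the adjoints: applying the operator to `∑_k u_{ik} u_{jk}^* =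
δ_{ij}` gives a linear system with coefficient matrix `u`, which unitarity solves. The same method
serves `dE_star_u` and `dF_star_u`. -/
lemma dK_star_u (r : Fin ℓ) (j k : Fin (ℓ + 1)) :
    dK r (star (u (q := q) j k)) = kWeight q r j • star (u j k) := by
  rw [eq_of_sum_u_mul (x := fun k => dK r (star (u (q := q) j k)))
    (y := fun i => if i = j then kWeight q r j • 1 else 0) _ k]
  · simp
  · intro i
    have h := congrArg (fun x => kWeight q r i • dK r x) (sum_u_star_u (q := q) i j)
    simp only [map_sum, dK_mul, dK_u, smul_mul_assoc, ← Finset.smul_sum, smul_smul,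
      mul_inv_cancel₀ (kWeight_ne_zero r i), one_smul] at h
    rw [h]
    by_cases hij : i = j
    · simp [hij, dK_one]
    · simp [hij]

lemma dKinv_star_u (r : Fin ℓ) (j k : Fin (ℓ + 1)) :
    dKinv r (star (u (q := q) j k)) = (kWeight q r j)⁻¹ • star (u j k) := by
  have := congrArg ((kWeight q r j)⁻¹ • dKinv r ·) (dK_star_u (q := q) r j k)
  simpa [dKinv_dK, smul_smul, kWeight_ne_zero] using this.symm

lemma dE_star_u (r : Fin ℓ) (j k : Fin (ℓ + 1)) :
    dE r (star (u (q := q) j k)) = if j = r.castSucc then star (u r.succ k) else 0 := by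
  rw [eq_of_sum_u_mul (x := fun k => dE r (star (u (q := q) j k)))
    (y := fun i => if i = r.succ then (if j = r.castSucc then 1 else 0) else 0) _ k]
  · simp
  · intro i
    have h := congrArg (fun x => kWeight q r i • dE r x) (sum_u_star_u (q := q) i j)
    simp only [map_sum, dE_mul, dK_u, dE_u, dKinv_star_u, smul_mul_assoc, mul_smul_comm,
      Finset.sum_add_distrib, smul_add, ← Finset.smul_sum, smul_smul,
      mul_inv_cancel₀ (kWeight_ne_zero r i), one_smul] at h
    have h0 : dE r (if i = j then (1 : SUq q ℓ) else 0) = 0 := by split_ifs <;> simp [dE_one]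
    rw [h0, smul_zero, add_eq_zero_iff_eq_neg] at h
    rw [h]
    by_cases hi : i = r.succ
    · subst hi
      simp only [if_true, smul_mul_assoc, ← Finset.smul_sum, sum_u_star_u]
      by_cases hj : j = r.castSucc
      · subst hj
        simp only [if_true, kWeight_succ, kWeight_castSucc, inv_inv, smul_smul, ← neg_smul, ← sq_sq]
        have := sq_ne_zero q
        -- The two factors `q^{1/2}` come from clearing `dK` on `u` and from `dKinv` on the adjoint;
        -- they cancel the `-q⁻¹` in `dE`, up to the sign from moving a term across.
        rw [show -(sq q * sq q * -(sq q ^ 2)⁻¹) = 1 by field_simp, one_smul]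
      · simp [hj, Ne.symm hj]
    · simp [hi]

lemma dF_star_u (r : Fin ℓ) (j k : Fin (ℓ + 1)) :
    dF r (star (u (q := q) j k)) = if j = r.succ then star (u r.castSucc k) else 0 := by
  rw [eq_of_sum_u_mul (x := fun k => dF r (star (u (q := q) j k)))
    (y := fun i => if i = r.castSucc then (if j = r.succ then 1 else 0) else 0) _ k]
  · simp
  · intro i
    have h := congrArg (fun x => kWeight q r i • dF r x) (sum_u_star_u (q := q) i j)
    simp only [map_sum, dF_mul, dK_u, dF_u, dKinv_star_u, smul_mul_assoc, mul_smul_comm,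
      Finset.sum_add_distrib, smul_add, ← Finset.smul_sum, smul_smul,
      mul_inv_cancel₀ (kWeight_ne_zero r i), one_smul] at h
    have h0 : dF r (if i = j then (1 : SUq q ℓ) else 0) = 0 := by split_ifs <;> simp [dF_one]
    rw [h0, smul_zero, add_eq_zero_iff_eq_neg] at h
    rw [h]
    by_cases hi : i = r.castSucc
    · subst hi
      simp only [if_true, smul_mul_assoc, ← Finset.smul_sum, sum_u_star_u]
      by_cases hj : j = r.succ
      · subst hj
        simp only [if_true, kWeight_succ, kWeight_castSucc, smul_smul, ← neg_smul, ← sq_sq]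
        have := sq_ne_zero q
        rw [show -((sq q)⁻¹ * (sq q)⁻¹ * -(sq q ^ 2)) = 1 by field_simp, one_smul]
      · simp [hj, Ne.symm hj]
    · simp [hi]

/-! ### Twisted forms of degree zero as sections -/

/-- The elements `f` such that `f ⊗ 1` is a twisted form of degree zero. -/
structure IsSection (M : ℤ) (f : SUq q ℓ) : Prop where
  dK_last : ∀ r : Fin ℓ, r.val + 1 = ℓ → dK r f = sq q ^ M • f
  dK_of_lt : ∀ r : Fin ℓ, r.val + 1 < ℓ → dK r f = f
  dE_of_lt : ∀ r : Fin ℓ, r.val + 1 < ℓ → dE r f = 0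
  dF_of_lt : ∀ r : Fin ℓ, r.val + 1 < ℓ → dF r f = 0

namespace IsSection
variable {M : ℤ} {f : SUq q ℓ}

lemma dKinv_last (hf : IsSection M f) (r : Fin ℓ) (hr : r.val + 1 = ℓ) :
    dKinv r f = sq q ^ (-M) • f := by
  have := congrArg (sq q ^ (-M) • dKinv r ·) (hf.dK_last r hr)
  simp only [dKinv_dK, map_smul, smul_smul] at this
  rw [this, ← zpow_add₀ (sq_ne_zero q)]
  simp

lemma dKinv_of_lt (hf : IsSection M f) (r : Fin ℓ) (hr : r.val + 1 < ℓ) : dKinv r f = f := by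
  have := congrArg (dKinv r) (hf.dK_of_lt r hr)
  rw [← this, dKinv_dK]

end IsSection

lemma tensorOp_single (T : Module.End ℂ (SUq q ℓ)) (A : ExtOp ℓ) (I J : Finset (Fin ℓ))
    (x : SUq q ℓ) : tensorOp T A (Pi.single I x) J = A J I • T x := by
  rw [tensorOp_apply, Finset.sum_eq_single I]
  · simp
  · intro K _ hK; simp [hK]
  · simp

lemma eq_single_of_mem_Omega {M : ℤ} {ω : Forms q ℓ} (h : ω ∈ Omega q ℓ M 0) :
    ω = Pi.single ∅ (ω ∅) := by
  ext I
  by_cases hI : I = ∅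
  · subst hI; simp
  · rw [Pi.single_eq_of_ne hI]
    exact h.1 I (by simpa using hI)

lemma sigmaK_empty (r s : Fin ℓ) (J : Finset (Fin ℓ)) :
    sigmaK q r s J ∅ = if J = ∅ then 1 else 0 := by simp [sigmaK]

lemma sigmaE_empty (r s : Fin ℓ) (J : Finset (Fin ℓ)) : sigmaE r s J ∅ = 0 := by simp [sigmaE]

lemma sigmaF_empty (r s : Fin ℓ) (J : Finset (Fin ℓ)) : sigmaF r s J ∅ = 0 := by simp [sigmaF]

/-- On `e_∅` the operators `σ(E_r)` and `σ(F_r)` vanish and `σ(K_r)` is the identity, so the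
invariance conditions fall on the coefficient alone. -/
lemma single_mem_Omega_iff {M : ℤ} {f : SUq q ℓ} :
    (Pi.single ∅ f : Forms q ℓ) ∈ Omega q ℓ M 0 ↔ IsSection M f := by
  constructor
  · rintro ⟨-, h2, h3⟩
    refine ⟨fun r hr => by simpa using h2 r hr ∅, fun r hr => ?_, fun r hr => ?_, fun r hr => ?_⟩
    · simpa [tensorOp_single, sigmaK_empty] using congrFun (h3 r ⟨r + 1, hr⟩ rfl).1 ∅
    · simpa [tensorOp_single, sigmaK_empty, sigmaE_empty] using
        congrFun (h3 r ⟨r + 1, hr⟩ rfl).2.1 ∅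
    · simpa [tensorOp_single, sigmaK_empty, sigmaF_empty] using
        congrFun (h3 r ⟨r + 1, hr⟩ rfl).2.2 ∅
  · intro hf
    refine ⟨fun I hI => Pi.single_eq_of_ne (fun h => hI (by simp [h])) _, fun r hr I => ?_,
      fun r s hs => ?_⟩
    · by_cases hI : I = ∅
      · subst hI; simpa using hf.dK_last r hr
      · simp [Pi.single_eq_of_ne hI]
    · have hr : r.val + 1 < ℓ := by rw [← hs]; exact s.2
      refine ⟨?_, ?_, ?_⟩ <;> ext J <;>
        simp only [Pi.add_apply, tensorOp_single, sigmaK_empty, sigmaE_empty, sigmaF_empty,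
          hf.dK_of_lt r hr, hf.dE_of_lt r hr, hf.dF_of_lt r hr, smul_zero, zero_smul, add_zero,
          Pi.zero_apply]
      by_cases hJ : J = ∅
      · subst hJ; simp
      · simp [hJ]

lemma isSection_of_mem_Omega {M : ℤ} {ω : Forms q ℓ} (h : ω ∈ Omega q ℓ M 0) :
    IsSection M (ω ∅) := by
  rw [eq_single_of_mem_Omega h] at h
  exact single_mem_Omega_iff.1 h

lemma mul_single_empty (a f : SUq q ℓ) :
    (fun I => a * (Pi.single ∅ f : Forms q ℓ) I) = Pi.single ∅ (a * f) := by
  ext I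
  by_cases hI : I = ∅
  · subst hI; simp
  · simp [hI]

/-! ### The action on `z_N`, on `u_{iN}^*` and on `y_ℓ` -/

lemma last_eq_succ {r : Fin ℓ} (hr : r.val + 1 = ℓ) : Fin.last ℓ = r.succ := by
  ext; simp [hr]

lemma last_ne_succ {r : Fin ℓ} (hr : r.val + 1 < ℓ) : Fin.last ℓ ≠ r.succ := by
  intro h; have := congrArg Fin.val h; simp at this; omega

lemma last_ne_castSucc (r : Fin ℓ) : Fin.last ℓ ≠ r.castSucc := (Fin.castSucc_ne_last r).symm

lemma kWeight_last_of_lt {r : Fin ℓ} (hr : r.val + 1 < ℓ) : kWeight q r (Fin.last ℓ) = 1 := by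
  rw [kWeight, if_neg (last_ne_succ hr), if_neg (last_ne_castSucc r)]

lemma kWeight_last {r : Fin ℓ} (hr : r.val + 1 = ℓ) : kWeight q r (Fin.last ℓ) = sq q := by
  rw [last_eq_succ hr, kWeight_succ]

lemma dE_z_last {r : Fin ℓ} (hr : r.val + 1 < ℓ) : dE r (z (q := q) (Fin.last ℓ)) = 0 := by
  rw [z, dE_u, if_neg (last_ne_succ hr)]

lemma dF_z_last (r : Fin ℓ) : dF r (z (q := q) (Fin.last ℓ)) = 0 := by
  rw [z, dF_u, if_neg (last_ne_castSucc r)]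

/-- Only the corner entry `u_{NN}` occurs here. Its weight under `K_r` cancels against that of its
adjoint, and the `E_r` and `F_r` with `r < ℓ` kill both. -/
lemma yl_eq : (yl q ℓ : SUq q ℓ) = 1 - z (Fin.last ℓ) * star (z (Fin.last ℓ)) := sum_z_star_z

lemma dK_yl (r : Fin ℓ) : dK r (yl q ℓ : SUq q ℓ) = yl q ℓ := by
  rw [yl_eq, map_sub, dK_one, dK_mul, z, dK_u, dK_star_u, smul_mul_smul_comm,
    inv_mul_cancel₀ (kWeight_ne_zero _ _), one_smul]

lemma dE_yl {r : Fin ℓ} (hr : r.val + 1 < ℓ) : dE r (yl q ℓ : SUq q ℓ) = 0 := by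
  rw [yl_eq, map_sub, dE_one, dE_mul, dE_z_last hr, z, dE_star_u, if_neg (last_ne_castSucc r)]
  simp

lemma dF_yl {r : Fin ℓ} (hr : r.val + 1 < ℓ) : dF r (yl q ℓ : SUq q ℓ) = 0 := by
  rw [yl_eq, map_sub, dF_one, dF_mul, dF_z_last, z, dF_star_u, if_neg (last_ne_succ hr)]
  simp

variable (q) in
/-- `z_N u_{iN}^*`. -/
def zStarU (i : Fin ℓ) : SUq q ℓ := z (Fin.last ℓ) * star (u i.castSucc (Fin.last ℓ))

/-- The starting point for all components of the gradient: `F_ℓ` kills `z_N` and sends `z_N^*` to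
`u_{ℓN}^*`, while `K_ℓ` acts on `z_N` by `q^{-1/2}`. -/
lemma dF_yl_last {r : Fin ℓ} (hr : r.val + 1 = ℓ) :
    dF r (yl q ℓ : SUq q ℓ) = (-(sq q)⁻¹) • zStarU q r := by
  rw [yl_eq, map_sub, dF_one, dF_mul, dF_z_last, z, dF_star_u, if_pos (last_eq_succ hr), dK_u,
    kWeight_last hr, zStarU, z]
  simp

lemma dK_zStarU (r i : Fin ℓ) : dK r (zStarU q i)
    = ((kWeight q r (Fin.last ℓ))⁻¹ * kWeight q r i.castSucc) • zStarU q i := by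
  rw [zStarU, dK_mul, z, dK_u, dK_star_u, smul_mul_smul_comm]

lemma dKinv_zStarU (r i : Fin ℓ) : dKinv r (zStarU q i)
    = (kWeight q r (Fin.last ℓ) * (kWeight q r i.castSucc)⁻¹) • zStarU q i := by
  rw [zStarU, dKinv_mul, z, dKinv_u, dKinv_star_u, smul_mul_smul_comm]

lemma castSucc_eq_succ_iff {r i s : Fin ℓ} (hs : s.val = r.val + 1) :
    i.castSucc = r.succ ↔ i = s := by
  simp [Fin.ext_iff, hs]

lemma dE_zStarU {r s : Fin ℓ} (hs : s.val = r.val + 1) (i : Fin ℓ) :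
    dE r (zStarU q i) = if i = r then zStarU q s else 0 := by
  have hr : r.val + 1 < ℓ := by rw [← hs]; exact s.2
  rw [zStarU, dE_mul, dE_z_last hr, dE_star_u, z, dK_u, kWeight_last_of_lt hr,
    ← (castSucc_eq_succ_iff hs).2 rfl]
  by_cases h : i = r <;> simp [h, zStarU, z]

/-- For `r < ℓ` the operators act only on the index `i` of `z_N u_{iN}^*`, because `z_N` is fixed by
`K_r` and killed by `F_r`. This step from `s` to `r` drives the recursion in
`IsSection.dMstar_yl_mul`. -/
lemma dF_zStarU {r s : Fin ℓ} (hs : s.val = r.val + 1) (i : Fin ℓ) :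
    dF r (zStarU q i) = if i = s then zStarU q r else 0 := by
  have hr : r.val + 1 < ℓ := by rw [← hs]; exact s.2
  rw [zStarU, dF_mul, dF_z_last, dF_star_u, z, dK_u, kWeight_last_of_lt hr]
  by_cases h : i = s <;> simp [h, castSucc_eq_succ_iff hs, zStarU, z]

lemma kWeight_castSucc_of {r s : Fin ℓ} (hs : s.val = r.val + 1) (i : Fin ℓ) :
    kWeight q r i.castSucc = if i = s then sq q else if i = r then (sq q)⁻¹ else 1 := by
  simp [kWeight, castSucc_eq_succ_iff hs]

lemma kWeight_castSucc_of_last {r : Fin ℓ} (hr : r.val + 1 = ℓ) (i : Fin ℓ) :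
    kWeight q r i.castSucc = if i = r then (sq q)⁻¹ else 1 := by
  rw [kWeight, if_neg]
  · simp
  · rw [← last_eq_succ hr]; exact Fin.castSucc_ne_last i

lemma IsSection.yl_mul {M : ℤ} {f : SUq q ℓ} (hf : IsSection M f) :
    IsSection M ((yl q ℓ : SUq q ℓ) * f) where
  dK_last r hr := by rw [dK_mul, dK_yl, hf.dK_last r hr, mul_smul_comm]
  dK_of_lt r hr := by rw [dK_mul, dK_yl, hf.dK_of_lt r hr]
  dE_of_lt r hr := by rw [dE_mul, dE_yl hr, hf.dE_of_lt r hr, mul_zero, zero_mul, add_zero]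
  dF_of_lt r hr := by rw [dF_mul, dF_yl hr, hf.dF_of_lt r hr, mul_zero, zero_mul, add_zero]

/-! ### The gradient of `y_ℓ` on smooth sections -/

variable (q) in
/-- The coefficients `q^{-3/2} (-q)^{i-ℓ}`. -/
def gradCoeff (i : Fin ℓ) : ℂ := (sq q)⁻¹ ^ 3 * (-((q : ℝ) : ℂ)⁻¹) ^ (ℓ - (i + 1))

/-- The ratio `-q⁻¹` is the coefficient in the recursion for `M_i^*`. It is also the ratio that the
invariance of the resulting one-form demands. -/
lemma gradCoeff_succ {r s : Fin ℓ} (hs : s.val = r.val + 1) :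
    gradCoeff q r = -((q : ℝ) : ℂ)⁻¹ * gradCoeff q s := by
  have : ℓ - (r + 1) = (ℓ - (s + 1)) + 1 := by have := s.2; omega
  rw [gradCoeff, gradCoeff, this, pow_succ]; ring

variable (q) in
/-- The components of the gradient of `y_ℓ`, as elements that act by left multiplication. -/
def gradElem (i : Fin ℓ) : SUq q ℓ := gradCoeff q i • zStarU q i

lemma dMstar_of_lt {i s : Fin ℓ} (hs : s.val = i.val + 1) : dMstar (q := q) i
    = dMstar s * dF i - ((q : ℝ) : ℂ)⁻¹ • (dF i * dMstar s) := by
  have hi : i.val + 1 < ℓ := by rw [← hs]; exact s.2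
  have : s = ⟨i.val + 1, hi⟩ := Fin.ext hs
  rw [dMstar, dif_pos hi, this]

lemma dN_of_lt {i s : Fin ℓ} (hs : s.val = i.val + 1) : dN (q := q) i = dK i * dN s := by
  have hi : i.val + 1 < ℓ := by rw [← hs]; exact s.2
  have : s = ⟨i.val + 1, hi⟩ := Fin.ext hs
  rw [dN, dif_pos hi, this]

lemma dMstar_of_last {i : Fin ℓ} (hi : i.val + 1 = ℓ) : dMstar (q := q) i = dF i := by
  rw [dMstar, dif_neg (by omega)]

lemma dN_of_last {i : Fin ℓ} (hi : i.val + 1 = ℓ) : dN (q := q) i = dK i := by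
  rw [dN, dif_neg (by omega)]

/-- Downward induction on `Fin ℓ`. -/
lemma fin_down_induction {P : Fin ℓ → Prop} (last : ∀ i : Fin ℓ, i.val + 1 = ℓ → P i)
    (step : ∀ i s : Fin ℓ, s.val = i.val + 1 → P s → P i) (i : Fin ℓ) : P i := by
  induction h : ℓ - (i.val + 1) generalizing i with
  | zero => exact last i (by have := i.2; omega)
  | succ n ih =>
    have hi : i.val + 1 < ℓ := by omega
    exact step i ⟨i.val + 1, hi⟩ rfl (ih _ (by simp; omega))

lemma dN_mul (i : Fin ℓ) (x y : SUq q ℓ) : dN i (x * y) = dN i x * dN i y := by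
  induction i using fin_down_induction with
  | last i hi => rw [dN_of_last hi, dK_mul]
  | step i s hs ih => simp only [dN_of_lt hs, Module.End.mul_apply, ih, dK_mul]

lemma dN_yl (i : Fin ℓ) : dN i (yl q ℓ : SUq q ℓ) = yl q ℓ := by
  induction i using fin_down_induction with
  | last i hi => rw [dN_of_last hi, dK_yl]
  | step i s hs ih => simp only [dN_of_lt hs, Module.End.mul_apply, ih, dK_yl]

lemma IsSection.dN_apply {M : ℤ} {f : SUq q ℓ} (hf : IsSection M f) (i : Fin ℓ) :
    dN i f = sq q ^ M • f := by
  induction i using fin_down_induction with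
  | last i hi => rw [dN_of_last hi, hf.dK_last i hi]
  | step i s hs ih =>
    rw [dN_of_lt hs, Module.End.mul_apply, ih, map_smul, hf.dK_of_lt i (by rw [← hs]; exact s.2)]

/-- The application has `j = i`, but the induction step evaluates `N_{i+1}` at an index `j` below `i
+ 1`, which is why all `j ≤ i` are included. -/
lemma dN_zStarU (i j : Fin ℓ) (hij : j ≤ i) :
    dN i (zStarU q j) = ((sq q)⁻¹ * if j = i then (sq q)⁻¹ else 1) • zStarU q j := by
  induction i using fin_down_induction with
  | last i hi => rw [dN_of_last hi, dK_zStarU, kWeight_last hi, kWeight_castSucc_of_last hi]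
  | step i s hs ih =>
    have his : i.val < s.val := by omega
    have hr : i.val + 1 < ℓ := by rw [← hs]; exact s.2
    have hjs : j ≠ s := fun h => by subst h; exact absurd hij (not_le.2 (Fin.lt_def.2 his))
    rw [dN_of_lt hs, Module.End.mul_apply, ih (hij.trans (Fin.lt_def.2 his).le), map_smul,
      dK_zStarU, kWeight_last_of_lt hr, kWeight_castSucc_of hs, if_neg hjs, if_neg hjs, smul_smul]
    simp

/-- Below the last index `F_i` kills both `f` and `y f`, so only the term `-q⁻¹ F_i M_{i+1}^*` of
the recursion acts. It commutes with `y` and turns `z_N u_{i+1,N}^*` into `z_N u_{iN}^*`. -/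
lemma IsSection.dMstar_yl_mul {M : ℤ} {f : SUq q ℓ} (hf : IsSection M f) (i : Fin ℓ) :
    dMstar i ((yl q ℓ : SUq q ℓ) * f) = yl q ℓ * dMstar i f -
      (sq q ^ (2 - M) * gradCoeff q i) • (zStarU q i * f) := by
  have hs0 := sq_ne_zero q
  induction i using fin_down_induction with
  | last i hi =>
    have h1 : gradCoeff q i = (sq q)⁻¹ ^ 3 := by simp [gradCoeff, hi]
    rw [dMstar_of_last hi, dF_mul, dK_yl, dF_yl_last hi, hf.dKinv_last i hi, smul_mul_smul_comm, h1,
      sub_eq_add_neg, ← neg_smul]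
    -- The constant is `q^{-1/2}` from `dF_yl_last` times `q^{-M/2}` from `K_ℓ⁻¹ f`, written as
    -- `q^{(2-M)/2} q^{-3/2}`.
    congr 2
    rw [sub_eq_add_neg, zpow_add₀ hs0]
    field_simp
  | step i s hs ih =>
    have hi : i.val + 1 < ℓ := by rw [← hs]; exact s.2
    rw [dMstar_of_lt hs]
    simp only [LinearMap.sub_apply, LinearMap.smul_apply, Module.End.mul_apply, hf.dF_of_lt i hi,
      hf.yl_mul.dF_of_lt i hi, map_zero, zero_sub, ih, map_sub, map_smul, dF_mul, dK_yl, dF_yl hi,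
      dF_zStarU hs, if_true, hf.dKinv_of_lt i hi, mul_zero, zero_mul, add_zero, zero_add,
      gradCoeff_succ hs]
    simp only [mul_neg, mul_smul_comm, smul_sub, smul_smul]
    module

/-- `N_i` multiplies `z_N u_{iN}^*` by `q⁻¹` and `f` by `q^{M/2}`. Together these cancel
`q^{(2-M)/2}`, and the twist `M` drops out of the gradient. -/
lemma IsSection.dN_dMstar_yl_mul {M : ℤ} {f : SUq q ℓ} (hf : IsSection M f) (i : Fin ℓ) :
    dN i (dMstar i ((yl q ℓ : SUq q ℓ) * f)) = yl q ℓ * dN i (dMstar i f) - gradElem q i * f := by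
  have hs0 := sq_ne_zero q
  rw [hf.dMstar_yl_mul, map_sub, dN_mul, dN_yl, map_smul, dN_mul,
    dN_zStarU i i le_rfl, if_pos rfl, hf.dN_apply, smul_mul_smul_comm, smul_smul, gradElem,
    smul_mul_assoc]
  congr 2
  have : sq q ^ (2 - M) * sq q ^ M = sq q ^ 2 := by
    rw [← zpow_add₀ hs0]; simp
  calc _ = (sq q ^ (2 - M) * sq q ^ M) * ((sq q)⁻¹ * (sq q)⁻¹) * gradCoeff q i := by ring
    _ = _ := by rw [this]; field_simp

/-! ### The Dirac operator on degree zero and its commutator with `yl` -/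

lemma extMul_empty (i : Fin ℓ) (J : Finset (Fin ℓ)) :
    extMul q i J ∅ = if J = {i} then 1 else 0 := by simp [extMul]

lemma extMul_conjTranspose_empty (i : Fin ℓ) (J : Finset (Fin ℓ)) :
    (extMul q i).conjTranspose J ∅ = 0 := by
  have h : ∅ ≠ insert i J := (Finset.insert_ne_empty i J).symm
  simp [extMul, Matrix.conjTranspose_apply, h]

/-- The adjoints of the `ε_i^q` annihilate `e_∅`, and `ε_i^q e_∅ = e_{i}` with coefficient one, as
the exponent of `-q` is zero. -/
lemma dirac_single_empty (f : SUq q ℓ) :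
    dirac (Pi.single ∅ f) = ∑ i, Pi.single {i} (dN i (dMstar i f)) := by
  ext J
  simp only [dirac, dbar, dbarDag, LinearMap.add_apply, LinearMap.sum_apply, Pi.add_apply,
    Finset.sum_apply, tensorOp_single, extMul_empty, extMul_conjTranspose_empty, zero_smul,
    Finset.sum_const_zero, add_zero]
  refine Finset.sum_congr rfl fun i _ => ?_
  by_cases h : J = {i}
  · subst h; simp
  · simp [h]

/-- The form `∑_i x_i f ⊗ e_i`, where `x` is `gradElem`. -/
def gradForm (f : SUq q ℓ) : Forms q ℓ := ∑ i, Pi.single {i} (gradElem q i * f)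

/-- The terms `y d_{N_i M_i^*} f` cancel, so the commutator acts on `f` by left multiplications
only; boundedness of the gradient follows from this. -/
lemma neg_commutator_dirac_yl {M : ℤ} {f : SUq q ℓ} (hf : IsSection M f) :
    -(dirac (fun I => (yl q ℓ : SUq q ℓ) * (Pi.single ∅ f : Forms q ℓ) I) -
      fun I => (yl q ℓ : SUq q ℓ) * dirac (Pi.single ∅ f) I) = gradForm f := by
  rw [mul_single_empty, dirac_single_empty, dirac_single_empty, gradForm]
  ext J
  simp only [Pi.neg_apply, Pi.sub_apply, Finset.sum_apply, Finset.mul_sum,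
    ← Finset.sum_sub_distrib, ← Finset.sum_neg_distrib]
  refine Finset.sum_congr rfl fun i _ => ?_
  rw [hf.dN_dMstar_yl_mul]
  by_cases h : J = {i}
  · subst h; simp
  · simp [h]

/-! ### The gradient of a section is a twisted form of degree one -/

lemma gradForm_singleton (f : SUq q ℓ) (i : Fin ℓ) : gradForm f {i} = gradElem q i * f := by
  rw [gradForm, Finset.sum_apply, Finset.sum_eq_single i]
  · simp
  · intro j _ hj; rw [Pi.single_eq_of_ne]; simpa using hj.symm
  · simp

lemma gradForm_of_card_ne (f : SUq q ℓ) {I : Finset (Fin ℓ)} (hI : I.card ≠ 1) :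
    gradForm f I = 0 := by
  rw [gradForm, Finset.sum_apply]
  refine Finset.sum_eq_zero fun i _ => Pi.single_eq_of_ne ?_ _
  rintro rfl; simp at hI

lemma tensorOp_gradForm (T : Module.End ℂ (SUq q ℓ)) (A : ExtOp ℓ) (f : SUq q ℓ)
    (J : Finset (Fin ℓ)) :
    tensorOp T A (gradForm f) J = ∑ i, A J {i} • T (gradElem q i * f) := by
  simp only [gradForm, map_sum, Finset.sum_apply, tensorOp_single]

lemma sigmaK_singleton {r s : Fin ℓ} (hrs : r ≠ s) (i : Fin ℓ) (J : Finset (Fin ℓ)) :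
    sigmaK q r s J {i}
      = if J = {i} then (if i = r then sq q else if i = s then (sq q)⁻¹ else 1) else 0 := by
  simp only [sigmaK, Matrix.of_apply, Finset.mem_singleton]
  by_cases hJ : J = {i}
  · rw [if_pos hJ, if_pos hJ]
    by_cases h1 : i = r
    · subst h1; simp [hrs.symm]
    · by_cases h2 : i = s
      · subst h2; simp [Ne.symm hrs, hrs]
      · simp [h1, h2, Ne.symm h1, Ne.symm h2]
  · rw [if_neg hJ, if_neg hJ]

lemma sigmaE_singleton {r s : Fin ℓ} (hrs : r ≠ s) (i : Fin ℓ) (J : Finset (Fin ℓ)) :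
    sigmaE r s J {i} = if i = s then (if J = {r} then 1 else 0) else 0 := by
  by_cases h : i = s
  · subst h; simp [sigmaE, hrs]
  · simp [sigmaE, h, Ne.symm h]

lemma sigmaF_singleton {r s : Fin ℓ} (hrs : r ≠ s) (i : Fin ℓ) (J : Finset (Fin ℓ)) :
    sigmaF r s J {i} = if i = r then (if J = {s} then 1 else 0) else 0 := by
  by_cases h : i = r
  · subst h; simp [sigmaF, Ne.symm hrs]
  · simp [sigmaF, h, Ne.symm h]

/-- The weights of `z_N u_{iN}^*` under the `K_r` are those prescribed for the component at `e_i`.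
In the conditions for `E_r` and `F_r` only one component can be nonzero, `e_r` and `e_s`
respectively, and its two contributions cancel. -/
theorem gradForm_mem_Omega {M : ℤ} {f : SUq q ℓ} (hf : IsSection M f) :
    gradForm f ∈ Omega q ℓ M 1 := by
  have hs0 := sq_ne_zero q
  refine ⟨fun I hI => gradForm_of_card_ne f hI, fun r hr I => ?_, fun r s hs => ?_⟩
  · by_cases hI : I.card = 1
    · obtain ⟨i, rfl⟩ := Finset.card_eq_one.1 hI
      rw [gradForm_singleton, gradElem, smul_mul_assoc, map_smul, dK_mul, dK_zStarU,
        hf.dK_last r hr, kWeight_last hr, kWeight_castSucc_of_last hr, smul_mul_smul_comm,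
        smul_comm]
      congr 1
      by_cases h : i = r
      · subst h
        simp only [if_true, Finset.card_singleton, Finset.mem_singleton, zpow_sub₀ hs0]
        simp; field_simp
      · simp only [if_neg h, Finset.card_singleton, Finset.mem_singleton, Ne.symm h, zpow_sub₀ hs0]
        simp; field_simp
    · rw [gradForm_of_card_ne f hI, map_zero, smul_zero]
  · have hr : r.val + 1 < ℓ := by rw [← hs]; exact s.2
    have hrs : r ≠ s := fun h => by subst h; omega
    have hK : ∀ i, dK r (gradElem q i * f) = kWeight q r i.castSucc • (gradElem q i * f) := by
      intro i
      rw [dK_mul, gradElem, map_smul, dK_zStarU, kWeight_last_of_lt hr, hf.dK_of_lt r hr, inv_one,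
        one_mul, smul_comm, smul_mul_assoc]
    have hKinv : ∀ i, dKinv r (gradElem q i * f)
        = (kWeight q r i.castSucc)⁻¹ • (gradElem q i * f) := by
      intro i
      rw [dKinv_mul, gradElem, map_smul, dKinv_zStarU, kWeight_last_of_lt hr, hf.dKinv_of_lt r hr,
        one_mul, smul_comm, smul_mul_assoc]
    have hE : ∀ i, dE r (gradElem q i * f)
        = if i = r then gradCoeff q r • (zStarU q s * f) else 0 := by
      intro i
      rw [dE_mul, hf.dE_of_lt r hr, mul_zero, zero_add, gradElem, map_smul, dE_zStarU hs,
        hf.dKinv_of_lt r hr]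
      by_cases h : i = r
      · subst h; simp
      · simp [h]
    have hF : ∀ i, dF r (gradElem q i * f)
        = if i = s then gradCoeff q s • (zStarU q r * f) else 0 := by
      intro i
      rw [dF_mul, hf.dF_of_lt r hr, mul_zero, zero_add, gradElem, map_smul, dF_zStarU hs,
        hf.dKinv_of_lt r hr]
      by_cases h : i = s
      · subst h; simp
      · simp [h]
    refine ⟨?_, ?_, ?_⟩ <;> ext J
    · rw [tensorOp_gradForm, gradForm, Finset.sum_apply]
      refine Finset.sum_congr rfl fun i _ => ?_
      rw [hK, kWeight_castSucc_of hs, sigmaK_singleton hrs]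
      by_cases hJ : J = {i}
      · subst hJ
        by_cases h1 : i = r
        · subst h1; simp [hrs, smul_smul, hs0]
        · by_cases h2 : i = s
          · subst h2; simp [h1, smul_smul, hs0]
          · simp [h1, h2]
      · simp [hJ]
    · simp only [Pi.add_apply, Pi.zero_apply, tensorOp_gradForm, hE, hKinv, sigmaK_singleton hrs,
        sigmaE_singleton hrs, smul_ite, smul_zero, ite_smul, zero_smul, Finset.sum_ite_eq',
        Finset.mem_univ, if_true, kWeight_castSucc_of hs]
      by_cases hJ : J = {r}
      · simp only [if_pos hJ, gradElem, smul_mul_assoc, gradCoeff_succ hs, smul_smul,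
          ← add_smul, ← sq_sq]
        -- The coefficient is `q^{1/2} · (-q⁻¹) + q^{-1/2}`, up to the common factor `gradCoeff q
        -- s`. The condition for `F_r` below gives the same two terms with the roles exchanged.
        convert zero_smul ℂ _
        field_simp; ring
      · simp [hJ]
    · simp only [Pi.add_apply, Pi.zero_apply, tensorOp_gradForm, hF, hKinv, sigmaK_singleton hrs,
        sigmaF_singleton hrs, smul_ite, smul_zero, ite_smul, zero_smul, Finset.sum_ite_eq',
        Finset.mem_univ, if_true, kWeight_castSucc_of hs, if_neg hrs, if_neg hrs.symm]
      by_cases hJ : J = {s}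
      · simp only [if_pos hJ, gradElem, smul_mul_assoc, gradCoeff_succ hs, smul_smul,
          ← add_smul, ← sq_sq]
        convert zero_smul ℂ _
        field_simp; ring
      · simp [hJ]

/-! ### Inner products of gradients -/

lemma star_gradCoeff (i : Fin ℓ) : star (gradCoeff q i) = gradCoeff q i := by
  simp [gradCoeff, sq]

/-- The coefficients are real with squares `q^{2i - 2ℓ - 1}`, where `i` counts from 0, so this is
`sum_star_mul_self_z_last` multiplied by `q^{-(2ℓ+1)}`. -/
lemma sum_star_gradElem_mul_gradElem :
    ∑ i : Fin ℓ, star (gradElem q i) * gradElem q i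
      = ((q : ℝ) : ℂ)⁻¹ • ((yl q ℓ : SUq q ℓ) * (1 - ((q : ℝ) : ℂ) ^ 2 • (yl q ℓ : SUq q ℓ))) := by
  have hq := qc_ne_zero q
  have hs0 := sq_ne_zero q
  have h := congrArg (((q : ℝ) : ℂ)⁻¹ ^ (2 * ℓ + 1) • ·) (sum_star_mul_self_z_last (q := q) (ℓ := ℓ))
  simp only [smul_smul, Finset.smul_sum] at h
  have e : ((q : ℝ) : ℂ)⁻¹ ^ (2 * ℓ + 1) * ((q : ℝ) : ℂ) ^ (2 * ℓ) = ((q : ℝ) : ℂ)⁻¹ := by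
    rw [pow_succ, inv_pow]; field_simp
  rw [e] at h
  rw [← h]
  refine Finset.sum_congr rfl fun i _ => ?_
  rw [gradElem, star_smul, star_gradCoeff, smul_mul_smul_comm]
  congr 1
  -- Removes the truncated subtraction from the exponent of `gradCoeff`.
  obtain ⟨m, hm⟩ : ∃ m, ℓ = i + 1 + m := ⟨ℓ - (i + 1), by have := i.2; omega⟩
  have hm' : ℓ - (i + 1) = m := by omega
  calc gradCoeff q i * gradCoeff q i = ((sq q ^ 2)⁻¹) ^ 3 * (((q : ℝ) : ℂ)⁻¹ ^ m) ^ 2 := by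
        rw [gradCoeff, hm', neg_pow]
        have : ((-1 : ℂ) ^ m) ^ 2 = 1 := by rw [← pow_mul, mul_comm, pow_mul]; simp
        linear_combination (((sq q ^ 2)⁻¹) ^ 3 * (((q : ℝ) : ℂ)⁻¹ ^ m) ^ 2) * this
    _ = ((q : ℝ) : ℂ)⁻¹ ^ (2 * (i + 1 + m) + 1) * ((q : ℝ) : ℂ) ^ (2 * (i : ℕ)) := by
        simp only [sq_sq, inv_pow]
        field_simp
        ring
    _ = _ := by rw [← hm]

/-- Only singletons carry nonzero components; `hF` discards the remaining subsets. -/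
lemma sum_gradForm {R : Type*} [AddCommMonoid R] (f g : SUq q ℓ) (F : SUq q ℓ → SUq q ℓ → R)
    (hF : F 0 0 = 0) :
    ∑ I, F (gradForm f I) (gradForm g I) = ∑ i, F (gradElem q i * f) (gradElem q i * g) := by
  simp only [← gradForm_singleton]
  refine Eq.trans ?_ (Finset.sum_map univ ⟨fun i : Fin ℓ => {i}, Finset.singleton_injective⟩
    (fun I => F (gradForm f I) (gradForm g I)))
  refine (Finset.sum_subset (Finset.subset_univ _) fun I _ hI => ?_).symm
  have h : I.card ≠ 1 := fun h => by
    obtain ⟨i, rfl⟩ := Finset.card_eq_one.1 h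
    exact hI (Finset.mem_map.2 ⟨i, Finset.mem_univ i, rfl⟩)
  rw [gradForm_of_card_ne f h, gradForm_of_card_ne g h, hF]

lemma inner_toL2Forms (α β : Forms q ℓ) :
    inner ℂ (toL2Forms α) (toL2Forms β) = ∑ I, haar q ℓ (star (α I) * β I) := by
  rw [PiLp.inner_apply]
  exact Finset.sum_congr rfl fun I _ => inner_toL2 _ _

/-- The sum of `(x_i f)^* (x_i g)` is `f^* (∑_i x_i^* x_i) g`. Having two sections `f` and `g` here
makes it possible to read off `∇^*∇` itself. -/
lemma inner_gradForm (f g : SUq q ℓ) :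
    inner ℂ (toL2Forms (gradForm f)) (toL2Forms (gradForm g))
      = haar q ℓ (star f * (((q : ℝ) : ℂ)⁻¹ • ((yl q ℓ : SUq q ℓ) *
          (1 - ((q : ℝ) : ℂ) ^ 2 • (yl q ℓ : SUq q ℓ))) * g)) := by
  rw [inner_toL2Forms, sum_gradForm f g (fun a b => haar q ℓ (star a * b)) (by simp), ← map_sum,
    ← sum_star_gradElem_mul_gradElem, Finset.sum_mul, Finset.mul_sum]
  simp only [star_mul, mul_assoc]

lemma inner_single_empty (f g : SUq q ℓ) :
    inner ℂ (toL2Forms (Pi.single ∅ f)) (toL2Forms (Pi.single ∅ g)) = haar q ℓ (star f * g) := by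
  rw [inner_toL2Forms, Finset.sum_eq_single ∅]
  · simp
  · intro I _ hI; simp [hI]
  · simp

/-! ### Extension to the Hilbert spaces and the adjoint -/

/-- A closed property of elements of `L²(Ω_M^0)` may be checked on smooth sections. -/
lemma L2Omega_zero_induction {M : ℤ} {P : L2Omega q ℓ M 0 → Prop} (hP : IsClosed {ξ | P ξ})
    (h : ∀ (f : SUq q ℓ) (hf : IsSection M f),
      P ⟨toL2Forms (Pi.single ∅ f), toL2Forms_mem (single_mem_Omega_iff.2 hf)⟩)
    (ξ : L2Omega q ℓ M 0) : P ξ := by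
  refine hP.closure_eq.subset (closure_subtype.2 (closure_mono ?_ ξ.2))
  rintro _ ⟨ω, hω, rfl⟩
  refine ⟨⟨toL2Forms ω, toL2Forms_mem hω⟩, ?_, rfl⟩
  have := h _ (isSection_of_mem_Omega hω)
  simp only [← eq_single_of_mem_Omega hω] at this
  exact this

variable (q ℓ) in
/-- The operator `ξ ↦ ∑_i x_i ξ_∅ ⊗ e_i`, where `x` is `gradElem`. -/
def gradOp : L2Forms q ℓ →L[ℂ] L2Forms q ℓ :=
  (PiLp.continuousLinearEquiv 2 ℂ (fun _ : Finset (Fin ℓ) => L2 q ℓ)).symm.toContinuousLinearMap ∘L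
    ContinuousLinearMap.pi (fun I => leftMul (gradForm 1 I) ∘L ContinuousLinearMap.proj ∅) ∘L
    (PiLp.continuousLinearEquiv 2 ℂ (fun _ : Finset (Fin ℓ) => L2 q ℓ)).toContinuousLinearMap

/-- Identifies `gradForm 1 I` as the multiplier of the component at `I`, which is how `gradOp`
encodes the gradient. -/
lemma gradForm_eq_mul (f : SUq q ℓ) (I : Finset (Fin ℓ)) : gradForm f I = gradForm 1 I * f := by
  by_cases hI : I.card = 1
  · obtain ⟨i, rfl⟩ := Finset.card_eq_one.1 hI
    simp [gradForm_singleton]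
  · simp [gradForm_of_card_ne _ hI]

lemma gradOp_toL2Forms (ω : Forms q ℓ) : gradOp q ℓ (toL2Forms ω) = toL2Forms (gradForm (ω ∅)) := by
  ext I
  refine (leftMul_toL2 (gradForm 1 I) (ω ∅)).trans ?_
  rw [← gradForm_eq_mul]
  rfl

lemma gradOp_mem {M : ℤ} (ξ : L2Omega q ℓ M 0) : gradOp q ℓ ξ ∈ L2Omega q ℓ M 1 := by
  induction ξ using L2Omega_zero_induction with
  | hP =>
    exact (Submodule.isClosed_topologicalClosure _).preimage
      ((gradOp q ℓ).continuous.comp continuous_subtype_val)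
  | h f hf =>
    rw [gradOp_toL2Forms, Pi.single_eq_same]
    exact toL2Forms_mem (gradForm_mem_Omega hf)

variable (q ℓ) in
/-- The gradient of `y_ℓ`, as an explicit bounded operator. -/
def gradYl (M : ℤ) : L2Omega q ℓ M 0 →L[ℂ] L2Omega q ℓ M 1 :=
  (gradOp q ℓ ∘L (L2Omega q ℓ M 0).subtypeL).codRestrict _ gradOp_mem

lemma isGradient_gradYl (M : ℤ) : IsGradient M (yl q ℓ) (gradYl q ℓ M) := by
  intro ω hω
  change gradOp q ℓ (toL2Forms ω) = _
  have h := neg_commutator_dirac_yl (isSection_of_mem_Omega hω)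
  rw [← eq_single_of_mem_Omega hω] at h
  rw [gradOp_toL2Forms, ← h, map_neg]

/-- `nabla` has the default value zero when no gradient exists. An explicit gradient excludes that
case, and uniqueness identifies it with the chosen one. -/
lemma IsGradient.nabla {M : ℤ} {x : CPq q ℓ} {T : L2Omega q ℓ M 0 →L[ℂ] L2Omega q ℓ M 1}
    (hT : IsGradient M x T) : nabla M x = T := by
  have h : ∃ T, IsGradient M x T := ⟨T, hT⟩
  rw [QuantumSU.nabla, dif_pos h]
  exact h.choose_spec.unique hT

/-- Ensures that the right-hand side of the main identity stays in `L²(Ω_M^0)`. The sections form a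
subspace, through `Omega`, which is stable under left multiplication by `y`. -/
lemma IsSection.yl_polynomial_mul {M : ℤ} {f : SUq q ℓ} (hf : IsSection M f) (c d : ℂ) :
    IsSection M (c • ((yl q ℓ : SUq q ℓ) * (1 - d • (yl q ℓ : SUq q ℓ))) * f) := by
  have hy : ∀ {g : SUq q ℓ}, IsSection M g → (Pi.single ∅ ((yl q ℓ : SUq q ℓ) * g) : Forms q ℓ) ∈
      Omega q ℓ M 0 := fun hg => single_mem_Omega_iff.2 hg.yl_mul
  have h : (Pi.single ∅ (c • ((yl q ℓ : SUq q ℓ) * (1 - d • (yl q ℓ : SUq q ℓ))) * f) : Forms q ℓ)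
      = c • ((Pi.single ∅ ((yl q ℓ : SUq q ℓ) * f) : Forms q ℓ) -
          d • (Pi.single ∅ ((yl q ℓ : SUq q ℓ) * (yl q ℓ * f)) : Forms q ℓ)) := by
    rw [← Pi.single_smul', ← Pi.single_sub, ← Pi.single_smul']
    congr 1
    simp only [smul_mul_assoc, mul_sub, sub_mul, mul_one, mul_smul_comm, mul_assoc]
  rw [← single_mem_Omega_iff, h]
  exact Submodule.smul_mem _ _ (Submodule.sub_mem _ (hy hf) (Submodule.smul_mem _ _ (hy hf.yl_mul)))

lemma adjoint_gradYl_gradYl (M : ℤ) (ξ : L2Omega q ℓ M 0) :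
    ((ContinuousLinearMap.adjoint (gradYl q ℓ M) (gradYl q ℓ M ξ) : L2Omega q ℓ M 0) :
        L2Forms q ℓ) =
      leftMulForms (((q : ℝ) : ℂ)⁻¹ • ((yl q ℓ : SUq q ℓ) *
        (1 - ((q : ℝ) : ℂ) ^ 2 • (yl q ℓ : SUq q ℓ)))) (ξ : L2Forms q ℓ) := by
  induction ξ using L2Omega_zero_induction with
  | hP => exact isClosed_eq (by fun_prop) (by fun_prop)
  | h f hf =>
    have hf' := hf.yl_polynomial_mul ((q : ℝ) : ℂ)⁻¹ (((q : ℝ) : ℂ) ^ 2)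
    rw [leftMulForms_toL2Forms, mul_single_empty]
    -- The adjoint is characterised by inner products within `L²(Ω_M^0)` only, so the equality has
    -- to be lifted from the ambient space to this subspace before it is tested on a dense set of
    -- vectors.
    suffices h : ContinuousLinearMap.adjoint (gradYl q ℓ M) (gradYl q ℓ M
        ⟨toL2Forms (Pi.single ∅ f), toL2Forms_mem (single_mem_Omega_iff.2 hf)⟩)
        = ⟨_, toL2Forms_mem (single_mem_Omega_iff.2 hf')⟩ from congrArg Subtype.val h
    refine ext_inner_left ℂ fun η => ?_
    induction η using L2Omega_zero_induction with
    | hP => exact isClosed_eq (by fun_prop) (by fun_prop)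
    | h g hg =>
      rw [ContinuousLinearMap.adjoint_inner_right, Submodule.coe_inner, Submodule.coe_inner,
        inner_single_empty, ← inner_gradForm]
      change inner ℂ (gradOp q ℓ (toL2Forms _)) (gradOp q ℓ (toL2Forms _)) = _
      rw [gradOp_toL2Forms, gradOp_toL2Forms, Pi.single_eq_same, Pi.single_eq_same]

end CoordinateAlgebra
end QuantumSU
end

open QuantumSU
theorem propositionp (q : Set.Ioo (0 : ℝ) 1) (ℓ : ℕ) (hℓ : 1 ≤ ℓ) (M : ℤ) :
    IsGradient M (yl q ℓ) (nabla M (yl q ℓ)) ∧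
    ∀ ξ : L2Omega q ℓ M 0,
      ((ContinuousLinearMap.adjoint (nabla M (yl q ℓ)) (nabla M (yl q ℓ) ξ) :
          L2Omega q ℓ M 0) : L2Forms q ℓ) =
        leftMulForms (((q : ℝ) : ℂ)⁻¹ • ((yl q ℓ : SUq q ℓ) *
          (1 - ((q : ℝ) : ℂ) ^ 2 • (yl q ℓ : SUq q ℓ)))) (ξ : L2Forms q ℓ) := by
  rw [(isGradient_gradYl M).nabla]
  exact ⟨isGradient_gradYl M, adjoint_gradYl_gradYl M⟩
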